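/- Let $R$ be an associative (not necessarily commutative) ring with $1$ and let $n\ge 3$. **Notation.** Let $E_{ij}(r)=I_n+re_{ij}$ ($i\ne j$, $r\in R$), let $\mathrm E_n(R)\le \mathrm{GL}_n(R)$ be the subgroup generated by these matrices, and let $K_{1,n}(R)=\mathrm{GL}_n(R)/\mathrm E_n(R)$ be the set of cosets $[\sigma]=\sigma \mathrm E_n(R)$. Let $\theta_n:\mathrm{St}_n(R)\to \mathrm{GL}_n(R)$, $X_{ij}(r)\mapsto E_{ij}(r)$, be the canonical map from the Steinberg group and $K_{2,n}(R)=\ker\theta_n$. A set $\alpha$ of pairs $(i,j)$, $i\neq j$, is nilpotent if $(i,j)\in\alpha$ implies $(j,i)\notin\alpha$, and $(i,j),(j,k)\in\alpha$ imply $(i,k)\in\alpha$. Let $\mathrm E_n(R)_\alpha$ and $\mathrm{St}_n(R)_\alpha$ be the (local) subgroups generated by the $E_{ij}(r)$, respectively $X_{ij}(r)$, with $(i,j)\in\alpha$. Let $\mathrm{Um}_n(R)$ be the set of rows $v\in R^n$ with $v w^t=\sum_i v_iw_i=1$ for some $w\in R^n$. Put $e=(1,0,\dots,0)$ and $\mathrm{EUm}_n(R)=e\,\mathrm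 E_n(R)$. Both sets are global actions under right multiplication by the local groups $\mathrm E_n(R)_\alpha$, $\alpha$ nilpotent. $\pi_0$ is the set of path components, and $\pi_1(\mathrm{EUm}_n(R))$ is the set of stable homotopy classes of loops at $e$, in the sense of global actions: a path is a map $\omega:\mathbb Z\to X$ that is constant near $-\infty$ and near $+\infty$ and for which, for each $k$, the points $\omega(k),\omega(k+1)$ lie in one orbit of some local group; a stable homotopy between loops at $e$ is a map $H:\mathbb Z\times\mathbb Z\to X$ for which each $H(\cdot,l)$ is a loop at $e$, the four points $H(k,l),H(k+1,l),H(k,l+1),H(k+1,l+1)$ always lie in one orbit of some local group, and $H(\cdot,l)$ is the first loop for all $l\ll 0$ and the second for all $l\gg 0$. Their base points are the component of $e$ and the class of the constant loop. Let $K^s_{0,m}(R)$ be the set of isomorphism classes of finitely generated projective right $R$-modules $P$ with $P\oplus R^r\cong R^{m+r}$ for some $r$, with base point $[R^m]$. Let $\mathrm{EP}_n(R)=\{\sigma\in \mathrm E_n(R): e\sigma=e\}$ and $\widetilde P_n(R)=\theta_n^{-1}(\mathrm{EP}_n(R))$. Let $(\mathrm{EP}_n(R))_2$ be the subgroup generated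 by the elements of $\mathrm{EP}_n(R)$ of the form $x^{-1}abx$ with $x\in \mathrm E_n(R)$, $a\in \mathrm E_n(R)_\alpha$, $b\in \mathrm E_n(R)_\beta$ for some nilpotent $\alpha,\beta$, and define $(\widetilde P_n(R))_2\le\widetilde P_n(R)$ in the same way inside $\mathrm{St}_n(R)$. Put $(K_{2,n}(R))_2=K_{2,n}(R)\cap(\widetilde P_n(R))_2$. Embed $\mathrm{GL}_{n-1}(R)$ in $\mathrm{GL}_n(R)$ by $\tau\mapsto\begin{pmatrix}1&0\\0&\tau\end{pmatrix}$. Put $(K_{1,n-1}(R))_2=(\mathrm{GL}_{n-1}(R)\cap(\mathrm{EP}_n(R))_2)/\mathrm E_{n-1}(R)$, and let $K_{1,n-1}(R)/(K_{1,n-1}(R))_2$ be the set of cosets of $\mathrm{GL}_{n-1}(R)\cap(\mathrm{EP}_n(R))_2$ in $\mathrm{GL}_{n-1}(R)$. The groups and coset spaces have the (classes of the) identity elements as base points. **Proposition.** The maps below are well defined, and the following are exact sequences of pointed sets. 1. $$K_{1,n}(R)\xrightarrow{\alpha}\pi_0(\mathrm{Um}_n(R))\xrightarrow{\beta}K^s_{0,n-1}(R)\xrightarrow{\gamma}K^s_{0,n}(R),$$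 where $\alpha([\sigma])=[e\sigma]$, $\beta([v])=[\ker(R^n\to R,\ w\mapsto v w^t)]$ and $\gamma([P])=[P\oplus R]$. 2. $$(K_{2,n}(R))_2\xrightarrow{\delta}K_{2,n}(R)\xrightarrow{\eta}\pi_1(\mathrm{EUm}_n(R))\xrightarrow{\mu}K_{1,n-1}(R)/(K_{1,n-1}(R))_2\xrightarrow{\lambda}K_{1,n}(R).$$ Here there is a well-defined bijection $\Phi:\widetilde P_n(R)/(\widetilde P_n(R))_2\to\pi_1(\mathrm{EUm}_n(R))$ which sends the coset of a product $y_1\cdots y_k\in\widetilde P_n(R)$ of elements of local groups $\mathrm{St}_n(R)_\alpha$ ($\alpha$ may vary) to the class of the loop $e,\ e\theta_n(y_1),\ e\theta_n(y_1y_2),\ \dots,\ e\theta_n(y_1\cdots y_k)=e$. The map $\delta$ is the inclusion, $\eta(Y)=\Phi(Y(\widetilde P_n(R))_2)$, $\mu(\Phi(Y(\widetilde P_n(R))_2))=[\tau]$ if $\theta_n(Y)=\begin{pmatrix}1&0\\v&\tau\end{pmatrix}$, and $\lambda([\tau])=\begin{pmatrix}1&0\\0&\tau\end{pmatrix}\mathrm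 E_n(R)$. -/

import Mathlib

universe u v w

open scoped Matrix

namespace UmRow

/-! ## Exact sequences of pointed sets -/

/-- `f : (X, x₀) → (Y, y₀)` and `g : (Y, y₀) → (Z, z₀)` are maps of pointed sets and
the sequence `X → Y → Z` is exact at `Y`: the fibre of `g` over `z₀` is the image of `f`. -/
def PointedExact {X : Type*} {Y : Type*} {Z : Type*} (f : X → Y) (g : Y → Z)
    (x₀ : X) (y₀ : Y) (z₀ : Z) : Prop :=
  f x₀ = y₀ ∧ g y₀ = z₀ ∧ ∀ y : Y, g y = z₀ ↔ ∃ x : X, f x = y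

/-! ## Global actions -/

/-- A global action with underlying set `X`: groups `G α`, indexed by a set with a reflexive
relation, each acting on the right on a subset `loc α` of `X`, with structure homomorphisms
`G α → G β` for `α ≤ β` which are compatible with the actions on `loc α ∩ loc β` (and so
`G α` leaves this intersection invariant). -/
structure GlobalAction (X : Type u) where
  Idx : Type v
  le : Idx → Idx → Prop
  le_refl : ∀ a, le a a
  G : Idx → Type w
  grp : ∀ a, Group (G a)
  loc : Idx → Set X
  act : ∀ a, loc a → G a → loc a
  act_one : ∀ a x, act a x 1 = x
  act_mul : ∀ a x g h, act a x (g * h) = act a (act a x g) h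
  str : ∀ {a b}, le a b → (G a →* G b)
  compat : ∀ {a b} (hab : le a b) (x : X) (ha : x ∈ loc a) (hb : x ∈ loc b) (g : G a),
    (act a ⟨x, ha⟩ g : X) = act b ⟨x, hb⟩ (str hab g)

namespace GlobalAction

/-- The points `x 0, …, x p` form an `a`-frame at `x 0`. -/
def IsFrame {X : Type*} (A : GlobalAction X) (a : A.Idx) {p : ℕ} (x : Fin (p + 1) → X) : Prop :=
  ∃ h : x 0 ∈ A.loc a, ∀ j, ∃ g : A.G a, (A.act a ⟨x 0, h⟩ g : X) = x j

/-- Morphisms of global actions are the maps that preserve local frames. -/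
def IsMorphism {X : Type*} {Y : Type*} (A : GlobalAction X) (B : GlobalAction Y)
    (f : X → Y) : Prop :=
  ∀ (a : A.Idx) (p : ℕ) (x : Fin (p + 1) → X), A.IsFrame a x → ∃ b : B.Idx, B.IsFrame b (f ∘ x)

/-- The product of two global actions. -/
def prod {X : Type*} {Y : Type*} (A : GlobalAction X) (B : GlobalAction Y) :
    GlobalAction (X × Y) where
  Idx := A.Idx × B.Idx
  le a b := A.le a.1 b.1 ∧ B.le a.2 b.2
  le_refl a := ⟨A.le_refl a.1, B.le_refl a.2⟩
  G a := A.G a.1 × B.G a.2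
  grp a := let := A.grp a.1; let := B.grp a.2; inferInstance
  loc a := A.loc a.1 ×ˢ B.loc a.2
  act a x g := ⟨(A.act a.1 ⟨x.1.1, x.2.1⟩ g.1, B.act a.2 ⟨x.1.2, x.2.2⟩ g.2),
    (A.act a.1 ⟨x.1.1, x.2.1⟩ g.1).2, (B.act a.2 ⟨x.1.2, x.2.2⟩ g.2).2⟩
  act_one a x := by
    let := A.grp a.1
    let := B.grp a.2
    apply Subtype.ext
    exact Prod.ext (congrArg Subtype.val (A.act_one a.1 ⟨x.1.1, x.2.1⟩))
      (congrArg Subtype.val (B.act_one a.2 ⟨x.1.2, x.2.2⟩))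
  act_mul a x g h := by
    let := A.grp a.1
    let := B.grp a.2
    apply Subtype.ext
    exact Prod.ext (congrArg Subtype.val (A.act_mul a.1 ⟨x.1.1, x.2.1⟩ g.1 h.1))
      (congrArg Subtype.val (B.act_mul a.2 ⟨x.1.2, x.2.2⟩ g.2 h.2))
  str {a b} hab :=
    let := A.grp a.1; let := B.grp a.2; let := A.grp b.1; let := B.grp b.2
    MonoidHom.prodMap (A.str hab.1) (B.str hab.2)
  compat {a b} hab x ha hb g :=
    Prod.ext (A.compat hab.1 x.1 ha.1 hb.1 g.1) (B.compat hab.2 x.2 ha.2 hb.2 g.2)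

/-- The local groups of the line action: `ℤ/2` (written multiplicatively) at `some n`, and the
trivial group at `none`, which plays the role of the index `*`. -/
def LineGroup : Option ℤ → Type
  | none => Unit
  | some _ => Multiplicative (ZMod 2)

instance lineGroupInst : ∀ a, Group (LineGroup a)
  | none => inferInstanceAs (Group (Multiplicative Unit))
  | some _ => inferInstanceAs (Group (Multiplicative (ZMod 2)))

/-- The local sets of the line action. -/
def lineLoc : Option ℤ → Set ℤ
  | none => Set.univ
  | some n => {n, n + 1}

/-- The local actions of the line action: for the index `n` the nontrivial element of `ℤ/2`
exchanges `n` and `n + 1`. -/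
def lineAct : ∀ a, lineLoc a → LineGroup a → lineLoc a
  | none, x, _ => x
  | some n, x, g => if Multiplicative.toAdd (α := ZMod 2) g = 0 then x else
      ⟨2 * n + 1 - x, by
        obtain ⟨x, hx⟩ := x
        rcases hx with rfl | rfl
        · right; show _ = _; ring
        · left; ring⟩

/-- The order of the index set of the line action: `* ≤ n` and `n ≤ n`. -/
def lineLe (a b : Option ℤ) : Prop := a = none ∨ a = b

/-- The structure homomorphisms of the line action. -/
def lineStr : ∀ {a b : Option ℤ}, lineLe a b → (LineGroup a →* LineGroup b)
  | none, _, _ => 1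
  | some n, b, h => by
      have hb : some n = b := h.resolve_left (by simp)
      subst hb
      exact MonoidHom.id _

lemma lineAct_one : ∀ (a : Option ℤ) (x : lineLoc a), lineAct a x 1 = x
  | none, _ => rfl
  | some _, x => by
    unfold lineAct
    exact if_pos (toAdd_one (α := ZMod 2))

/-- The line action. -/
def line : GlobalAction ℤ where
  Idx := Option ℤ
  le := lineLe
  le_refl _ := Or.inr rfl
  G := LineGroup
  grp := lineGroupInst
  loc := lineLoc
  act := lineAct
  act_one := lineAct_one
  act_mul a x g h := by
    cases a with
    | none => rfl
    | some n =>
      have key : ∀ g h : ZMod 2, g + h = 0 ↔ (g = 0 ↔ h = 0) := by decide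
      have key' := key (Multiplicative.toAdd (α := ZMod 2) g) (Multiplicative.toAdd (α := ZMod 2) h)
      have e : Multiplicative.toAdd (α := ZMod 2) (g * h : LineGroup (some n)) =
        Multiplicative.toAdd (α := ZMod 2) g + Multiplicative.toAdd (α := ZMod 2) h := rfl
      apply Subtype.ext
      simp only [lineAct, e]
      split_ifs <;> simp_all
  str := lineStr
  compat {a b} hab x ha hb g := by
    cases a with
    | none =>
      cases b with
      | none => rfl
      | some n => exact (congrArg Subtype.val (lineAct_one (some n) ⟨x, hb⟩)).symm
    | some n =>
      have hb' : some n = b := hab.resolve_left (by simp)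
      subst hb'
      rfl

/-- `ω` is a path from `x` to `y`: a morphism from the line action which stabilizes on the left
to `x` and on the right to `y`. -/
def IsPath {X : Type*} (A : GlobalAction X) (x y : X) (ω : ℤ → X) : Prop :=
  IsMorphism line A ω ∧ (∃ N : ℤ, ∀ n ≤ N, ω n = x) ∧ (∃ N : ℤ, ∀ n ≥ N, ω n = y)

/-- Two points are path connected. -/
def PathConnected {X : Type*} (A : GlobalAction X) (x y : X) : Prop := ∃ ω, IsPath A x y ω

/-- The set of path components. -/
def Pi0 {X : Type*} (A : GlobalAction X) : Type _ := Quot (PathConnected A)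

/-- The path component of a point. -/
def Pi0.mk {X : Type*} (A : GlobalAction X) (x : X) : Pi0 A := Quot.mk _ x

/-- The loops at `x`. -/
def Loop {X : Type*} (A : GlobalAction X) (x : X) : Type _ := {ω : ℤ → X // IsPath A x x ω}

/-- Two loops at `x` are stably homotopic if they are the initial and the terminal path of a
homotopy `H : L × L → A` for which all `H (·, n)` are loops at `x`. -/
def StablyHomotopic {X : Type*} (A : GlobalAction X) (x : X) (ω ω' : Loop A x) : Prop :=
  ∃ H : ℤ × ℤ → X, IsMorphism (line.prod line) A H ∧
    (∀ n : ℤ, IsPath A x x (fun k => H (k, n))) ∧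
    (∃ N : ℤ, ∀ n ≤ N, (fun k => H (k, n)) = ω.1) ∧
    (∃ N : ℤ, ∀ n ≥ N, (fun k => H (k, n)) = ω'.1)

/-- The underlying set of the fundamental group: stable homotopy classes of loops at `x`. -/
def Pi1 {X : Type*} (A : GlobalAction X) (x : X) : Type _ := Quot (StablyHomotopic A x)

/-- The stable homotopy class of a loop. -/
def Pi1.mk {X : Type*} (A : GlobalAction X) (x : X) (ω : Loop A x) : Pi1 A x := Quot.mk _ ω

/-- The constant loop at `x`. -/
def constLoop {X : Type*} (A : GlobalAction X) (x : X) (a : A.Idx) (h : x ∈ A.loc a) :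
    Loop A x :=
  ⟨fun _ => x, fun _ _ _ _ => ⟨a, h, fun _ => ⟨let := A.grp a; 1, by
    let := A.grp a
    exact congrArg Subtype.val (A.act_one a ⟨x, h⟩)⟩⟩, ⟨0, fun _ _ => rfl⟩, ⟨0, fun _ _ => rfl⟩⟩

end GlobalAction

open GlobalAction

/-! ## Elementary matrices, the elementary group, the Steinberg group -/

variable (R : Type u) [Ring R]

/-- `GL_n(R)`, the group of invertible `n × n` matrices over a (not necessarily commutative)
ring. -/
abbrev GLn (n : ℕ) : Type u := (Matrix (Fin n) (Fin n) R)ˣ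

variable {R}

lemma elem_mul_elem {n : ℕ} {i j : Fin n} (h : i ≠ j) (r s : R) :
    (1 + Matrix.single i j r : Matrix (Fin n) (Fin n) R) * (1 + Matrix.single i j s) =
      1 + Matrix.single i j (r + s) := by
  simp only [mul_add, add_mul, mul_one, one_mul,
    Matrix.single_mul_single_of_ne _ _ _ _ h.symm, Matrix.single_add, add_zero]
  abel

/-- The elementary matrix `E_{ij}(r) = I + r e_{ij}`. -/
def elem {n : ℕ} (i j : Fin n) (h : i ≠ j) (r : R) : GLn R n where
  val := 1 + Matrix.single i j r
  inv := 1 + Matrix.single i j (-r)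
  val_inv := by rw [elem_mul_elem h]; simp
  inv_val := by rw [elem_mul_elem h]; simp

variable (R)

/-- The elementary group `E_n(R)`, generated by all elementary matrices. -/
def En (n : ℕ) : Subgroup (GLn R n) :=
  Subgroup.closure {g | ∃ (i j : Fin n) (h : i ≠ j) (r : R), g = elem i j h r}

/-- `K_{1,n}(R)`, the set of cosets `σ E_n(R)` in `GL_n(R)`. -/
abbrev K1 (n : ℕ) : Type u := GLn R n ⧸ En R n

/-- The generators `X_{ij}(r)`, `i ≠ j`, of the Steinberg group. -/
abbrev StGen (n : ℕ) : Type u := {p : Fin n × Fin n // p.1 ≠ p.2} × R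

variable {R}

/-- The commutator `[a, b] = a b a⁻¹ b⁻¹`. -/
def grpComm {G : Type*} [Group G] (a b : G) : G := a * b * a⁻¹ * b⁻¹

lemma map_grpComm {G H : Type*} [Group G] [Group H] (f : G →* H) (a b : G) :
    f (grpComm a b) = grpComm (f a) (f b) := by simp [grpComm]

/-- The generator `X_{ij}(r)` in the free group. -/
def freeX {n : ℕ} (i j : Fin n) (h : i ≠ j) (r : R) : FreeGroup (StGen R n) :=
  FreeGroup.of (⟨(i, j), h⟩, r)

/-- The defining relators of the Steinberg group. -/
inductive IsSteinbergRelator {n : ℕ} : FreeGroup (StGen R n) → Prop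
  | add (i j : Fin n) (h : i ≠ j) (r s : R) :
      IsSteinbergRelator (freeX i j h r * freeX i j h s * (freeX i j h (r + s))⁻¹)
  | comm (i j k l : Fin n) (hij : i ≠ j) (hkl : k ≠ l) (hjk : j ≠ k) (hil : i ≠ l) (r s : R) :
      IsSteinbergRelator (grpComm (freeX i j hij r) (freeX k l hkl s))
  | mul (i j l : Fin n) (hij : i ≠ j) (hjl : j ≠ l) (hil : i ≠ l) (r s : R) :
      IsSteinbergRelator (grpComm (freeX i j hij r) (freeX j l hjl s) * (freeX i l hil (r * s))⁻¹)

variable (R)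

/-- The Steinberg group `St_n(R)`. -/
abbrev St (n : ℕ) : Type u := PresentedGroup {x : FreeGroup (StGen R n) | IsSteinbergRelator x}

variable {R}

/-- The element `X_{ij}(r)` of the Steinberg group. -/
def stX {n : ℕ} (i j : Fin n) (h : i ≠ j) (r : R) : St R n :=
  PresentedGroup.of (⟨(i, j), h⟩, r)

lemma elem_comm {n : ℕ} (i j k l : Fin n) (hij : i ≠ j) (hkl : k ≠ l) (hjk : j ≠ k)
    (hil : i ≠ l) (r s : R) : grpComm (elem i j hij r) (elem k l hkl s) = 1 := by
  rw [grpComm, mul_inv_eq_one, mul_inv_eq_iff_eq_mul]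
  apply Units.ext
  simp only [elem, Units.val_mul, mul_add, add_mul, mul_one, one_mul,
    Matrix.single_mul_single_of_ne _ _ _ _ hjk, Matrix.single_mul_single_of_ne _ _ _ _ hil.symm,
    add_zero]
  abel

lemma elem_commutator {n : ℕ} (i j l : Fin n) (hij : i ≠ j) (hjl : j ≠ l) (hil : i ≠ l)
    (r s : R) : grpComm (elem i j hij r) (elem j l hjl s) = elem i l hil (r * s) := by
  rw [grpComm, mul_inv_eq_iff_eq_mul, mul_inv_eq_iff_eq_mul]
  apply Units.ext
  simp only [elem, Units.val_mul, mul_add, add_mul, mul_one, one_mul,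
    Matrix.single_mul_single_same, Matrix.single_mul_single_of_ne _ _ _ _ hil.symm,
    Matrix.single_mul_single_of_ne _ _ _ _ hjl.symm, add_zero]
  abel

/-- The canonical homomorphism `θ_n : St_n(R) → GL_n(R)`, `X_{ij}(r) ↦ E_{ij}(r)`. -/
def theta (n : ℕ) : St R n →* GLn R n :=
  PresentedGroup.toGroup (f := fun x : StGen R n => elem x.1.1.1 x.1.1.2 x.1.2 x.2) (by
    rintro x (⟨i, j, h, r, s⟩ | ⟨i, j, k, l, hij, hkl, hjk, hil, r, s⟩ |
      ⟨i, j, l, hij, hjl, hil, r, s⟩)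
    · simp only [freeX, map_mul, map_inv, FreeGroup.lift_apply_of]
      rw [mul_inv_eq_one]
      exact Units.ext (elem_mul_elem h r s)
    · simp only [freeX, map_grpComm, FreeGroup.lift_apply_of]
      exact elem_comm i j k l hij hkl hjk hil r s
    · simp only [freeX, map_mul, map_inv, map_grpComm, FreeGroup.lift_apply_of]
      rw [mul_inv_eq_one]
      exact elem_commutator i j l hij hjl hil r s)

lemma theta_stX {n : ℕ} (i j : Fin n) (h : i ≠ j) (r : R) :
    theta n (stX i j h r) = elem i j h r :=
  PresentedGroup.toGroup.of _

variable (R)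

/-- `K_{2,n}(R)`, the kernel of `θ_n`. -/
def K2 (n : ℕ) : Subgroup (St R n) := (theta n).ker

/-! ## Local groups -/

/-- Nilpotent sets of off-diagonal positions. -/
def NilSet (n : ℕ) : Type :=
  {a : Set (Fin n × Fin n) // (∀ i j, (i, j) ∈ a → i ≠ j) ∧ (∀ i j, (i, j) ∈ a → (j, i) ∉ a) ∧
    ∀ i j k, (i, j) ∈ a → (j, k) ∈ a → (i, k) ∈ a}

/-- The local group `GL_n(R)_α = E_n(R)_α`, generated by the `E_{ij}(r)` with `(i, j) ∈ α`; as `α`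
is nilpotent, it consists of the matrices with diagonal entries `1` and with entry `0` at each
off-diagonal position outside `α`. -/
def locGL (n : ℕ) (a : NilSet n) : Subgroup (GLn R n) :=
  Subgroup.closure {g | ∃ (i j : Fin n) (h : i ≠ j) (r : R), (i, j) ∈ a.1 ∧ g = elem i j h r}

/-- The local group `St_n(R)_α`, generated by the `X_{ij}(r)` with `(i, j) ∈ α`. -/
def locSt (n : ℕ) (a : NilSet n) : Subgroup (St R n) :=
  Subgroup.closure {g | ∃ (i j : Fin n) (h : i ≠ j) (r : R), (i, j) ∈ a.1 ∧ g = stX i j h r}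

lemma locGL_mono (n : ℕ) {a b : NilSet n} (h : a.1 ⊆ b.1) : locGL R n a ≤ locGL R n b := by
  apply Subgroup.closure_mono
  rintro g ⟨i, j, hij, r, ha, rfl⟩
  exact ⟨i, j, hij, r, h ha, rfl⟩

lemma locGL_le (n : ℕ) (a : NilSet n) : locGL R n a ≤ En R n := by
  apply Subgroup.closure_mono
  rintro g ⟨i, j, hij, r, ha, rfl⟩
  exact ⟨i, j, hij, r, rfl⟩

/-- For subgroups `H ≤ N` of `G` and a family `F` of subgroups of `N`, the subgroup `H₂` of `H`
generated by the elements of `H` of the form `x⁻¹ a b x` with `x ∈ N` and `a`, `b` in members of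
the family. -/
def sub2 {G : Type*} [Group G] {I : Type*} (F : I → Subgroup G) (N H : Subgroup G) : Subgroup G :=
  Subgroup.closure {h | h ∈ H ∧ ∃ x ∈ N, ∃ (α β : I), ∃ a ∈ F α, ∃ b ∈ F β, h = x⁻¹ * a * b * x}

/-! ## Unimodular rows -/

/-- The unimodular rows `v`: there is `w` with `∑ v_i w_i = 1`. -/
def UmSet (n : ℕ) : Set (Fin n → R) := {v | ∃ w : Fin n → R, v ⬝ᵥ w = 1}

/-- The row `e = (1, 0, …, 0)`. -/
def e1 (m : ℕ) : Fin (m + 1) → R := Pi.single 0 1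

/-- The set `EUm_n(R) = e E_n(R)`, `n = m + 1`. -/
def EUmSet (m : ℕ) : Set (Fin (m + 1) → R) :=
  {v | ∃ ε ∈ En R (m + 1), v = e1 R m ᵥ* (ε : Matrix (Fin (m + 1)) (Fin (m + 1)) R)}

/-- The single domain global action on a set `S` of rows that is invariant under the local groups
`GL_n(R)_α`, which act by right multiplication. -/
def rowAction {n : ℕ} (S : Set (Fin n → R))
    (hS : ∀ (a : NilSet n), ∀ g ∈ locGL R n a, ∀ v ∈ S,
      v ᵥ* (g : Matrix (Fin n) (Fin n) R) ∈ S) : GlobalAction S where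
  Idx := NilSet n
  le a b := a.1 ⊆ b.1
  le_refl _ := subset_rfl
  G a := locGL R n a
  grp _ := inferInstance
  loc _ := Set.univ
  act a x g := ⟨⟨x.1.1 ᵥ* ((g : GLn R n) : Matrix (Fin n) (Fin n) R), hS a g g.2 _ x.1.2⟩, trivial⟩
  act_one a x := by
    apply Subtype.ext; apply Subtype.ext
    simp
  act_mul a x g h := by
    apply Subtype.ext; apply Subtype.ext
    simp [Matrix.vecMul_vecMul]
  str hab := Subgroup.inclusion (locGL_mono R n hab)
  compat hab x ha hb g := rfl

variable {R}

lemma vecMul_mem_UmSet {n : ℕ} {v : Fin n → R} (hv : v ∈ UmSet R n) (g : GLn R n) :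
    v ᵥ* (g : Matrix (Fin n) (Fin n) R) ∈ UmSet R n := by
  obtain ⟨w, hw⟩ := hv
  refine ⟨((g⁻¹ : GLn R n) : Matrix (Fin n) (Fin n) R) *ᵥ w, ?_⟩
  rw [Matrix.dotProduct_mulVec, Matrix.vecMul_vecMul, ← Units.val_mul]
  simpa using hw

lemma e1_mem_UmSet (m : ℕ) : e1 R m ∈ UmSet R (m + 1) := ⟨e1 R m, by simp [e1]⟩

lemma vecMul_mem_EUmSet {m : ℕ} {v : Fin (m + 1) → R} (hv : v ∈ EUmSet R m)
    {g : GLn R (m + 1)} (hg : g ∈ En R (m + 1)) :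
    v ᵥ* (g : Matrix (Fin (m + 1)) (Fin (m + 1)) R) ∈ EUmSet R m := by
  obtain ⟨ε, hε, rfl⟩ := hv
  exact ⟨ε * g, mul_mem hε hg, by rw [Matrix.vecMul_vecMul, Units.val_mul]⟩

lemma e1_mem_EUmSet (m : ℕ) : e1 R m ∈ EUmSet R m := ⟨1, one_mem _, by simp⟩

variable (R)

/-- The unimodular row global action `Um_n(R)`. -/
def Um (n : ℕ) : GlobalAction (UmSet R n) :=
  rowAction R (UmSet R n) fun _ g _ _ hv => vecMul_mem_UmSet hv g

/-- The base point `e` of `Um_n(R)`, `n = m + 1`. -/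
def baseUm (m : ℕ) : UmSet R (m + 1) := ⟨e1 R m, e1_mem_UmSet m⟩

/-- The row `e σ` as an element of `Um_n(R)`, `n = m + 1`. -/
def e1Mul (m : ℕ) (σ : GLn R (m + 1)) : UmSet R (m + 1) :=
  ⟨e1 R m ᵥ* (σ : Matrix (Fin (m + 1)) (Fin (m + 1)) R), vecMul_mem_UmSet (e1_mem_UmSet m) σ⟩

/-- The elementary unimodular row global action `EUm_n(R)`, `n = m + 1`. -/
def EUm (m : ℕ) : GlobalAction (EUmSet R m) :=
  rowAction R (EUmSet R m) fun a _ hg _ hv => vecMul_mem_EUmSet hv (locGL_le R _ a hg)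

/-- The base point `e` of `EUm_n(R)`. -/
def baseEUm (m : ℕ) : EUmSet R m := ⟨e1 R m, e1_mem_EUmSet m⟩

/-- `π_1(EUm_n(R), e)`, `n = m + 1`. -/
abbrev Pi1EUm (m : ℕ) : Type _ := Pi1 (EUm R m) (baseEUm R m)

/-- The base point of `π_1(EUm_n(R), e)`, the class of the constant loop. -/
def Pi1EUm.base (m : ℕ) : Pi1EUm R m :=
  Pi1.mk _ _ (constLoop (EUm R m) (baseEUm R m)
    (⟨∅, fun _ _ h => h.elim, fun _ _ h => h.elim, fun _ _ _ h => h.elim⟩ : NilSet (m + 1)) trivial)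

/-! ## The groups `P_n(R)`, `EP_n(R)` and their relatives, for `n = m + 1` -/

/-- `P_n(R)`, the stabilizer of `e` in `GL_n(R)`. -/
def Pn (m : ℕ) : Subgroup (GLn R (m + 1)) where
  carrier := {σ | e1 R m ᵥ* (σ : Matrix (Fin (m + 1)) (Fin (m + 1)) R) = e1 R m}
  one_mem' := by simp
  mul_mem' {a b} ha hb := by
    simp only [Set.mem_ofPred_eq] at *
    rw [Units.val_mul, ← Matrix.vecMul_vecMul, ha, hb]
  inv_mem' {a} ha := by
    simp only [Set.mem_ofPred_eq] at *
    nth_rewrite 1 [← ha]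
    rw [Matrix.vecMul_vecMul, ← Units.val_mul]
    simp

/-- `EP_n(R) = P_n(R) ∩ E_n(R)`. -/
def EPn (m : ℕ) : Subgroup (GLn R (m + 1)) := Pn R m ⊓ En R (m + 1)

/-- `(EP_n(R))₂`, formed inside `E_n(R)`. -/
def EP2 (m : ℕ) : Subgroup (GLn R (m + 1)) := sub2 (locGL R (m + 1)) (En R (m + 1)) (EPn R m)

/-- The preimage `θ_n⁻¹(EP_n(R))` in the Steinberg group. -/
def PTilde (m : ℕ) : Subgroup (St R (m + 1)) := (EPn R m).comap (theta (m + 1))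

/-- `(θ_n⁻¹(EP_n(R)))₂`. -/
def PTilde2 (m : ℕ) : Subgroup (St R (m + 1)) := sub2 (locSt R (m + 1)) ⊤ (PTilde R m)

/-- `(K_{2,n}(R))₂ = K_{2,n}(R) ∩ (θ_n⁻¹(EP_n(R)))₂`. -/
def K2Two (m : ℕ) : Subgroup (St R (m + 1)) := K2 R (m + 1) ⊓ PTilde2 R m

/-- The set of cosets `Y (θ_n⁻¹(EP_n(R)))₂` in `θ_n⁻¹(EP_n(R))`. -/
abbrev PTildeQuot (m : ℕ) : Type u := ↥(PTilde R m) ⧸ (PTilde2 R m).subgroupOf (PTilde R m)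

variable {R}

lemma K2_le_PTilde (m : ℕ) : K2 R (m + 1) ≤ PTilde R m := by
  intro y hy
  have h : theta (m + 1) y = 1 := hy
  show theta (m + 1) y ∈ EPn R m
  rw [h]
  exact one_mem _

/-- The matrix `(1 0; 0 τ)`. -/
def stabMat {m : ℕ} (τ : Matrix (Fin m) (Fin m) R) : Matrix (Fin (m + 1)) (Fin (m + 1)) R :=
  Matrix.of (Fin.cons (Fin.cons 1 0) fun i => Fin.cons 0 (τ i))

lemma stabMat_one {m : ℕ} : stabMat (1 : Matrix (Fin m) (Fin m) R) = 1 := by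
  ext i j
  refine Fin.cases ?_ (fun i => ?_) i <;> refine Fin.cases ?_ (fun j => ?_) j <;>
    simp [stabMat, Matrix.one_apply, Fin.succ_ne_zero, (Fin.succ_ne_zero _).symm]

lemma stabMat_mul {m : ℕ} (σ τ : Matrix (Fin m) (Fin m) R) :
    stabMat (σ * τ) = stabMat σ * stabMat τ := by
  ext i j
  refine Fin.cases ?_ (fun i => ?_) i <;> refine Fin.cases ?_ (fun j => ?_) j <;>
    simp [stabMat, Matrix.mul_apply, Fin.sum_univ_succ]

/-- The right diagonal inclusion `GL_{n-1}(R) → GL_n(R)`, `τ ↦ (1 0; 0 τ)`, `n = m + 1`. -/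
def stab (m : ℕ) : GLn R m →* GLn R (m + 1) :=
  Units.map { toFun := stabMat, map_one' := stabMat_one, map_mul' := stabMat_mul }

lemma rd_aux {m : ℕ} {σ τ : Matrix (Fin (m + 1)) (Fin (m + 1)) R}
    (hτ : e1 R m ᵥ* τ = e1 R m) (h : σ * τ = 1) :
    (Matrix.of fun i j : Fin m => σ i.succ j.succ) * (Matrix.of fun i j : Fin m => τ i.succ j.succ)
      = 1 := by
  ext i j
  have h0 : τ 0 j.succ = 0 := by
    have := congrFun hτ j.succ
    simpa [e1, Matrix.single_one_vecMul] using this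
  have h1 := congrFun (congrFun h i.succ) j.succ
  rw [Matrix.mul_apply, Fin.sum_univ_succ, h0] at h1
  simpa [Matrix.mul_apply, Matrix.one_apply] using h1

/-- The right diagonal block `τ ∈ GL_{n-1}(R)` of a matrix `(1 0; v τ)` in `P_n(R)`,
`n = m + 1`. -/
def rd {m : ℕ} (σ : Pn R m) : GLn R m where
  val := Matrix.of fun i j => ((σ : GLn R (m + 1)) : Matrix _ _ R) i.succ j.succ
  inv := Matrix.of fun i j => (((σ⁻¹ : Pn R m) : GLn R (m + 1)) : Matrix _ _ R) i.succ j.succ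
  val_inv := rd_aux (σ⁻¹ : Pn R m).2 (by simp)
  inv_val := rd_aux σ.2 (by simp)

/-- The right diagonal block of `θ_n(Y)`, for `Y` in `θ_n⁻¹(EP_n(R))`. -/
def rdTheta {m : ℕ} (Y : PTilde R m) : GLn R m := rd ⟨theta (m + 1) Y, Y.2.1⟩

variable (R)

/-- `GL_{n-1}(R) ∩ (EP_n(R))₂`, as a subgroup of `GL_{n-1}(R)`, `n = m + 1`. -/
def GL2 (m : ℕ) : Subgroup (GLn R m) := (EP2 R m).comap (stab m)

lemma stab_elem {m : ℕ} (i j : Fin m) (h : i ≠ j) (r : R) :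
    stab m (elem i j h r) = elem i.succ j.succ (by simpa using h) r := by
  apply Units.ext
  ext k l
  refine Fin.cases ?_ (fun k => ?_) k <;> refine Fin.cases ?_ (fun l => ?_) l <;>
    simp [stab, elem, stabMat, Matrix.one_apply, Matrix.single_apply, Fin.succ_ne_zero,
      (Fin.succ_ne_zero _).symm]

/-- `GL_{n-1}(R) ∩ (EP_n(R))₂` contains `E_{n-1}(R)`, so that the cosets of the former are the
classes of `K_{1,n-1}(R)` modulo `(K_{1,n-1}(R))₂ = (GL_{n-1}(R) ∩ (EP_n(R))₂) / E_{n-1}(R)`. -/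
lemma En_le_GL2 (m : ℕ) : En R m ≤ GL2 R m := by
  rw [En, Subgroup.closure_le]
  rintro _ ⟨i, j, h, r, rfl⟩
  have h' : i.succ ≠ j.succ := by simpa using h
  show stab m (elem i j h r) ∈ EP2 R m
  rw [stab_elem]
  refine Subgroup.subset_closure ⟨⟨?_, Subgroup.subset_closure ⟨_, _, h', r, rfl⟩⟩, 1, one_mem _,
    ⟨{(i.succ, j.succ)}, ?_, ?_, ?_⟩, ⟨{(i.succ, j.succ)}, ?_, ?_, ?_⟩, elem _ _ h' r,
    Subgroup.subset_closure ⟨_, _, h', r, rfl, rfl⟩, 1, one_mem _, by simp⟩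
  · show e1 R m ᵥ* (1 + Matrix.single _ _ r) = _
    ext l
    simp [e1, Matrix.one_apply, Pi.single_apply,
      eq_comm]
  all_goals simp only [Set.mem_singleton_iff, Prod.mk.injEq]; grind

/-- `K_{1,n-1}(R) / (K_{1,n-1}(R))₂`, `n = m + 1`: with `(K_{1,n-1}(R))₂ =
(GL_{n-1}(R) ∩ (EP_n(R))₂) / E_{n-1}(R)` this is the set of cosets of `GL_{n-1}(R) ∩ (EP_n(R))₂` in
`GL_{n-1}(R)`. -/
abbrev K1ModTwo (m : ℕ) : Type u := GLn R m ⧸ GL2 R m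

/-! ## Stably free modules. Right `R`-modules are modules over `Rᵐᵒᵖ`. -/

/-- The finitely generated projective right modules `P` with `P ⊕ R^r ≅ R^{m+r}` for some `r`. -/
structure StablyFree (m : ℕ) where
  carrier : Type u
  [grp : AddCommGroup carrier]
  [mod : Module Rᵐᵒᵖ carrier]
  finite : Module.Finite Rᵐᵒᵖ carrier
  projective : Module.Projective Rᵐᵒᵖ carrier
  stably : ∃ r : ℕ, Nonempty ((carrier × (Fin r → R)) ≃ₗ[Rᵐᵒᵖ] (Fin (m + r) → R))

attribute [instance] StablyFree.grp StablyFree.mod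

/-- Isomorphism of modules. -/
def stablyFreeSetoid (m : ℕ) : Setoid (StablyFree R m) where
  r P Q := Nonempty (P.carrier ≃ₗ[Rᵐᵒᵖ] Q.carrier)
  iseqv := ⟨fun _ => ⟨LinearEquiv.refl _ _⟩, fun ⟨e⟩ => ⟨e.symm⟩, fun ⟨e⟩ ⟨f⟩ => ⟨e.trans f⟩⟩

/-- `K^s_{0,m}(R)`, the set of isomorphism classes. -/
def Ks0 (m : ℕ) : Type (u + 1) := Quotient (stablyFreeSetoid R m)

variable {R}

/-- The class of a module in `K^s_{0,m}(R)`. -/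
def Ks0.mk {m : ℕ} (P : StablyFree R m) : Ks0 R m := Quotient.mk _ P

lemma finite_right (n : ℕ) : Module.Finite Rᵐᵒᵖ (Fin n → R) := by
  have : Module.Finite Rᵐᵒᵖ R :=
    Module.Finite.equiv (MulOpposite.opLinearEquiv Rᵐᵒᵖ (M := R)).symm
  infer_instance

lemma projective_right (n : ℕ) : Module.Projective Rᵐᵒᵖ (Fin n → R) := by
  have : Module.Free Rᵐᵒᵖ R :=
    Module.Free.of_equiv (MulOpposite.opLinearEquiv Rᵐᵒᵖ (M := R)).symm
  infer_instance

/-- A module with `P ⊕ R^r ≅ R^{m+r}` is finitely generated projective. -/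
def StablyFree.of {m : ℕ} (P : Type u) [AddCommGroup P] [Module Rᵐᵒᵖ P]
    (h : ∃ r : ℕ, Nonempty ((P × (Fin r → R)) ≃ₗ[Rᵐᵒᵖ] (Fin (m + r) → R))) :
    StablyFree R m where
  carrier := P
  finite := by
    obtain ⟨r, ⟨e⟩⟩ := h
    have := finite_right (R := R) (m + r)
    exact Module.Finite.of_surjective (LinearMap.fst Rᵐᵒᵖ P (Fin r → R) ∘ₗ e.symm.toLinearMap)
      ((LinearMap.fst_surjective (R := Rᵐᵒᵖ)).comp e.symm.surjective)
  projective := by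
    obtain ⟨r, ⟨e⟩⟩ := h
    have := projective_right (R := R) (m + r)
    exact Module.Projective.of_split (e.toLinearMap ∘ₗ LinearMap.inl Rᵐᵒᵖ P (Fin r → R))
      (LinearMap.fst Rᵐᵒᵖ P (Fin r → R) ∘ₗ e.symm.toLinearMap) (by ext; simp)
  stably := h

/-- `R^m` as an element of the class of modules defining `K^s_{0,m}(R)`. -/
def StablyFree.free (m : ℕ) : StablyFree R m :=
  StablyFree.of (Fin m → R) 
    ⟨0, ⟨(LinearEquiv.prodUnique : ((Fin m → R) × (Fin 0 → R)) ≃ₗ[Rᵐᵒᵖ] (Fin m → R))⟩⟩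

/-- `R × R^r ≅ R^{1+r}`, in the form needed for `P ⊕ R`. -/
def consEquiv (r : ℕ) : (R × (Fin r → R)) ≃ₗ[Rᵐᵒᵖ] (Fin (r + 1) → R) :=
  Fin.consLinearEquiv Rᵐᵒᵖ (fun _ : Fin (r + 1) => R)

/-- The stabilization `P ↦ P ⊕ R`. -/
def StablyFree.succ {m : ℕ} (P : StablyFree R m) : StablyFree R (m + 1) :=
  StablyFree.of (P.carrier × R) (by
    obtain ⟨r, ⟨e⟩⟩ := P.stably
    let f₁ := LinearEquiv.prodAssoc Rᵐᵒᵖ P.carrier R (Fin r → R)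
    let f₂ := LinearEquiv.prodCongr (LinearEquiv.refl Rᵐᵒᵖ P.carrier)
      (LinearEquiv.prodComm Rᵐᵒᵖ R (Fin r → R))
    let f₃ := (LinearEquiv.prodAssoc Rᵐᵒᵖ P.carrier (Fin r → R) R).symm
    let f₄ := LinearEquiv.prodCongr e (LinearEquiv.refl Rᵐᵒᵖ R)
    let f₅ := LinearEquiv.prodComm Rᵐᵒᵖ (Fin (m + r) → R) R
    let f₆ := LinearEquiv.funCongrLeft Rᵐᵒᵖ R (finCongr (show m + 1 + r = m + r + 1 by omega))
    exact ⟨r, ⟨(((((f₁.trans f₂).trans f₃).trans f₄).trans f₅).trans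
      (consEquiv (m + r))).trans f₆⟩⟩)

/-- The map of right modules `R^n → R`, `w ↦ v wᵗ = ∑ v_i w_i`. -/
def rowMap {n : ℕ} (v : Fin n → R) : (Fin n → R) →ₗ[Rᵐᵒᵖ] R where
  toFun w := v ⬝ᵥ w
  map_add' := dotProduct_add v
  map_smul' c w := dotProduct_smul c v w

/-- The map of right modules `R → R^n`, `c ↦ sᵗ c`. -/
def colMap {n : ℕ} (s : Fin n → R) : R →ₗ[Rᵐᵒᵖ] (Fin n → R) where
  toFun c i := s i * c
  map_add' a b := by ext i; simp [mul_add]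
  map_smul' a b := by ext i; simp [mul_assoc]

lemma rowMap_colMap {n : ℕ} {v s : Fin n → R} (h : v ⬝ᵥ s = 1) (c : R) :
    rowMap v (colMap s c) = c := by
  have : rowMap v (colMap s c) = (v ⬝ᵥ s) * c := by
    simp [rowMap, colMap, dotProduct, Finset.sum_mul, mul_assoc]
  rw [this, h, one_mul]

/-- If `v sᵗ = 1` then the kernel of `w ↦ v wᵗ` is a complement of a free module of rank one. -/
def kerEquiv {n : ℕ} {v s : Fin n → R} (h : v ⬝ᵥ s = 1) :
    (LinearMap.ker (rowMap v) × R) ≃ₗ[Rᵐᵒᵖ] (Fin n → R) where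
  toFun x := x.1 + colMap s x.2
  map_add' x y := by
    simp only [Prod.fst_add, Prod.snd_add, Submodule.coe_add, map_add]
    exact add_add_add_comm _ _ _ _
  map_smul' c x := by
    simp only [Prod.smul_fst, Prod.smul_snd, Submodule.coe_smul, map_smul, smul_add,
      RingHom.id_apply]
  invFun w := (⟨w - colMap s (rowMap v w), by
    rw [LinearMap.mem_ker, map_sub, rowMap_colMap h, sub_self]⟩, rowMap v w)
  left_inv x := by
    have hx : rowMap v (x.1 + colMap s x.2) = x.2 := by
      rw [map_add, rowMap_colMap h, LinearMap.mem_ker.1 x.1.2, zero_add]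
    refine Prod.ext (Subtype.ext ?_) hx
    simp only [hx, add_sub_cancel_right]
  right_inv w := sub_add_cancel _ _

/-- The kernel of `w ↦ v wᵗ` for a unimodular row `v` of length `m + 1`. -/
def StablyFree.ker {m : ℕ} (v : UmSet R (m + 1)) : StablyFree R m :=
  StablyFree.of (LinearMap.ker (rowMap v.1)) (by
    obtain ⟨s, hs⟩ := v.2
    exact ⟨1, ⟨(LinearEquiv.prodCongr (LinearEquiv.refl Rᵐᵒᵖ (LinearMap.ker (rowMap v.1)))
      (LinearEquiv.funUnique (Fin 1) Rᵐᵒᵖ R)).trans (kerEquiv hs)⟩⟩)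

/-! ## Loops in `EUm_n(R)` coming from words in the local groups of the Steinberg group -/

lemma theta_mem_En {n : ℕ} (y : St R n) : theta n y ∈ En R n := by
  have h : (⊤ : Subgroup (St R n)) ≤ (En R n).comap (theta n) := by
    rw [← PresentedGroup.closure_range_of, Subgroup.closure_le]
    rintro _ ⟨⟨⟨⟨i, j⟩, hij⟩, r⟩, rfl⟩
    exact Subgroup.subset_closure ⟨i, j, hij, r, theta_stX i j hij r⟩
  exact h (Subgroup.mem_top y)

/-- The point `e θ_n(y)` of `EUm_n(R)`, `n = m + 1`. -/
def stPoint {m : ℕ} (y : St R (m + 1)) : EUmSet R m :=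
  ⟨e1 R m ᵥ* (theta (m + 1) y : Matrix (Fin (m + 1)) (Fin (m + 1)) R), _, theta_mem_En y, rfl⟩

/-- The loop `ω` at `e` runs through `e, e θ(y₁), e θ(y₁ y₂), …, e θ(y₁ ⋯ y_k)`, where
`l = [y₁, …, y_k]`, starting at time `0`. -/
def Follows {m : ℕ} (ω : Loop (EUm R m) (baseEUm R m)) (l : List (St R (m + 1))) : Prop :=
  ∀ k : ℤ, ω.1 k = stPoint (l.take k.toNat).prod

end UmRow

open UmRow UmRow.GlobalAction

namespace UmRow

/-! ## Frames, paths and homotopies -/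

namespace GlobalAction

/-! The first sequence is linear algebra. Path components of `Um` are orbits of the elementary
group, because each elementary matrix moves a row along one edge. A unimodular row splits off a free
summand of rank one from `R^n`. An isomorphism of its kernel with `R^m` therefore assembles to an
invertible matrix carrying the row to `e` (`exists_eq_e1_vecMul`). Conversely, any `P` with `P ⊕ R ≅
R^n` is the kernel of the row describing the projection to `R` (`exists_kerEquiv`).

The second sequence rests on treating `stPoint`, `y ↦ e θ(y)`, as a covering. An edge lifts to right
multiplication by an element of a local Steinberg group, and two lifts differ by a generator of
`PTilde2` (`lift_unique`). Lifting a loop thus gives an end point modulo `PTilde2`, and passing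
across one row of squares of a homotopy does not change it (`prod_mul_inv_mem_of_close`). In the
other direction, the class of the loop of a word depends only on the product of the word. Each
Steinberg relation lives inside a single local group, where it can be carried out by a homotopy
(`stToUnits`, `mk_word`). Multiplying by a generator of `PTilde2` only exchanges one letter for
another reaching the same point (`stClass_mul`). The two constructions are inverse to each other
(`pi1Equiv`).

Exactness then becomes a statement about cosets. It uses that `θ` maps `PTilde2` onto `EP2`, and
that a matrix fixing `e` equals its diagonal block up to an element of `EP2` (`rd_mem_GL2_iff`). -/

lemma line_isFrame_bounds {a : line.Idx} {p : ℕ} {x : Fin (p + 1) → ℤ} (h : line.IsFrame a x) :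
    ∃ k : ℤ, ∀ j, x j = k ∨ x j = k + 1 := by
  obtain ⟨h0, h⟩ := h
  cases a with
  | none =>
    refine ⟨x 0, fun j => Or.inl ?_⟩
    obtain ⟨g, hg⟩ := h j
    exact hg.symm
  | some n =>
    refine ⟨n, fun j => ?_⟩
    obtain ⟨g, hg⟩ := h j
    have := (line.act (some n) ⟨x 0, h0⟩ g).2
    rw [hg] at this
    exact this

/-- Supplies the test frames: both ends of an edge are translates of its left end. -/
lemma line_act_swap (k : ℤ) (b : Bool) : ∃ g : line.G (some k),
    (line.act (some k) ⟨k, Or.inl rfl⟩ g : ℤ) = if b then k + 1 else k := by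
  cases b with
  | false => exact ⟨(Multiplicative.ofAdd (0 : ZMod 2) :), rfl⟩
  | true =>
    have h : ¬ Multiplicative.toAdd (Multiplicative.ofAdd (1 : ZMod 2)) = 0 := by decide
    exact ⟨(Multiplicative.ofAdd (1 : ZMod 2) :),
      (congrArg Subtype.val (if_neg (t := (⟨k, Or.inl rfl⟩ : lineLoc (some k))) h)).trans
        (show 2 * k + 1 - k = k + 1 by ring)⟩

end GlobalAction

/-! ### Morphisms tested on edges and squares -/

section RowAction

variable {R : Type u} [Ring R] {n : ℕ} {S : Set (Fin n → R)}

/-- Two rows lie in one orbit of the local group with index `a`. -/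
def Adj (a : NilSet n) (v w : S) : Prop :=
  ∃ g ∈ locGL R n a, w.1 = v.1 ᵥ* (g : Matrix (Fin n) (Fin n) R)

lemma Adj.refl (a : NilSet n) (v : S) : Adj a v v := ⟨1, one_mem _, by simp⟩

lemma Adj.symm {a : NilSet n} {v w : S} (h : Adj a v w) : Adj a w v := by
  obtain ⟨g, hg, h⟩ := h
  refine ⟨g⁻¹, inv_mem hg, ?_⟩
  rw [h, Matrix.vecMul_vecMul, ← Units.val_mul]
  simp

lemma Adj.trans {a : NilSet n} {v w x : S} (h : Adj a v w) (h' : Adj a w x) : Adj a v x := by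
  obtain ⟨g, hg, h⟩ := h
  obtain ⟨g', hg', h'⟩ := h'
  exact ⟨g * g', mul_mem hg hg', by rw [h', h, Matrix.vecMul_vecMul, ← Units.val_mul]⟩

variable {hS : ∀ (a : NilSet n), ∀ g ∈ locGL R n a, ∀ v ∈ S,
      v ᵥ* (g : Matrix (Fin n) (Fin n) R) ∈ S}

lemma rowAction_isFrame {a : NilSet n} {p : ℕ} {x : Fin (p + 1) → S} :
    (rowAction R S hS).IsFrame a x ↔ ∀ j, Adj a (x 0) (x j) := by
  constructor
  · rintro ⟨_, h⟩ j
    obtain ⟨g, hg⟩ := h j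
    exact ⟨g.1, g.2, by rw [← hg]; rfl⟩
  · intro h
    refine ⟨trivial, fun j => ?_⟩
    obtain ⟨g, hg, h⟩ := h j
    exact ⟨⟨g, hg⟩, Subtype.ext h.symm⟩

/-- Frames of the line fit inside an edge, and `Adj a` is an equivalence relation, so edges are the
only condition. -/
lemma isMorphism_line_iff {ω : ℤ → S} :
    IsMorphism line (rowAction R S hS) ω ↔ ∀ k, ∃ a, Adj a (ω k) (ω (k + 1)) := by
  constructor
  · intro h k
    obtain ⟨a, ha⟩ := h (some k) 1 (fun j => if j = 1 then k + 1 else k)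
      ⟨Or.inl rfl, fun j => by simpa using line_act_swap k (decide (j = 1))⟩
    exact ⟨a, by simpa using rowAction_isFrame.1 ha 1⟩
  · intro h a p x hx
    obtain ⟨k, hk⟩ := line_isFrame_bounds hx
    obtain ⟨b, hb⟩ := h k
    refine ⟨b, rowAction_isFrame.2 fun j => ?_⟩
    show Adj b (ω (x 0)) (ω (x j))
    rcases hk 0 with h0 | h0 <;> rcases hk j with hj | hj <;> rw [h0, hj]
    exacts [Adj.refl _ _, hb, hb.symm, Adj.refl _ _]

/-- All squares between consecutive points of `ω` and `ω'` lie in orbits of local groups. -/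
def Close (ω ω' : ℤ → S) : Prop :=
  ∀ k, ∃ a : NilSet n, Adj a (ω k) (ω (k + 1)) ∧ Adj a (ω k) (ω' k) ∧ Adj a (ω k) (ω' (k + 1))

lemma isMorphism_line_prod_iff {H : ℤ × ℤ → S} :
    IsMorphism (line.prod line) (rowAction R S hS) H ↔
      ∀ l, Close (fun k => H (k, l)) (fun k => H (k, l + 1)) := by
  constructor
  · intro h l k
    obtain ⟨a, ha⟩ := h (some k, some l) 3
      -- The index `j` is read in binary: its low bit moves `k`, its high bit moves `l`.
      (fun j => (if j = 1 ∨ j = 3 then k + 1 else k, if j = 2 ∨ j = 3 then l + 1 else l))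
      ⟨⟨Or.inl rfl, Or.inl rfl⟩, fun j => by
        obtain ⟨g, hg⟩ := line_act_swap k (decide (j = 1 ∨ j = 3))
        obtain ⟨g', hg'⟩ := line_act_swap l (decide (j = 2 ∨ j = 3))
        exact ⟨(g, g'), Prod.ext (hg.trans (by simp)) (hg'.trans (by simp))⟩⟩
    have ha := rowAction_isFrame.1 ha
    exact ⟨a, by simpa using ha 1, by simpa using ha 2, by simpa using ha 3⟩
  · rintro h ⟨a, b⟩ p x ⟨h0, hx⟩
    obtain ⟨k, hk⟩ := line_isFrame_bounds (a := a) (x := fun j => (x j).1)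
      ⟨h0.1, fun j => by
        obtain ⟨g, hg⟩ := hx j
        exact ⟨g.1, congrArg Prod.fst hg⟩⟩
    obtain ⟨l, hl⟩ := line_isFrame_bounds (a := b) (x := fun j => (x j).2)
      ⟨h0.2, fun j => by
        obtain ⟨g, hg⟩ := hx j
        exact ⟨g.2, congrArg Prod.snd hg⟩⟩
    obtain ⟨c, h1, h2, h3⟩ := h l k
    have key : ∀ j, Adj c (H (k, l)) (H (x j)) := by
      intro j
      rw [← Prod.mk.eta (p := x j)]
      rcases hk j with h | h <;> rcases hl j with h' | h' <;> rw [h, h']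
      exacts [Adj.refl _ _, h2, h1, h3]
    exact ⟨c, rowAction_isFrame.2 fun j => (key 0).symm.trans (key j)⟩

/-- The basic homotopy: one point of a path may be moved freely within a local orbit that also
contains both neighbours. -/
lemma close_of_eqOn_compl {ω ω' : ℤ → S} (hω : ∀ k, ∃ a, Adj a (ω k) (ω (k + 1))) (a : NilSet n)
    (k₀ : ℤ) (hne : ∀ k, k ≠ k₀ → ω' k = ω k) (h₁ : Adj a (ω (k₀ - 1)) (ω k₀))
    (h₂ : Adj a (ω (k₀ - 1)) (ω' k₀)) (h₃ : Adj a (ω (k₀ - 1)) (ω (k₀ + 1))) : Close ω ω' := by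
  intro k
  by_cases hk : k = k₀
  · subst hk
    refine ⟨a, h₁.symm.trans h₃, h₁.symm.trans h₂, ?_⟩
    rw [hne _ (by omega)]
    exact h₁.symm.trans h₃
  · by_cases hk' : k = k₀ - 1
    · subst hk'
      rw [hne _ hk, sub_add_cancel]
      exact ⟨a, h₁, Adj.refl _ _, h₂⟩
    · obtain ⟨b, hb⟩ := hω k
      rw [hne _ hk, hne (k + 1) (by omega)]
      exact ⟨b, hb, Adj.refl _ _, hb⟩

lemma close_self {ω : ℤ → S} (hω : ∀ k, ∃ a, Adj a (ω k) (ω (k + 1))) : Close ω ω := by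
  intro k
  obtain ⟨b, hb⟩ := hω k
  exact ⟨b, hb, Adj.refl _ _, hb⟩

lemma loop_adj {x : S} (ω : Loop (rowAction R S hS) x) (k : ℤ) :
    ∃ a, Adj a (ω.1 k) (ω.1 (k + 1)) :=
  isMorphism_line_iff.1 ω.2.1 k

/-- The homotopy is stationary except for the single step from row `0` to row `1`. -/
lemma stablyHomotopic_of_close {x : S} {ω ω' : Loop (rowAction R S hS) x}
    (h : Close ω.1 ω'.1) : StablyHomotopic (rowAction R S hS) x ω ω' := by
  refine ⟨fun p => if p.2 ≤ 0 then ω.1 p.1 else ω'.1 p.1, isMorphism_line_prod_iff.2 fun l => ?_,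
    fun l => ?_, ⟨0, fun l hl => ?_⟩, ⟨1, fun l hl => ?_⟩⟩
  · rcases lt_trichotomy l 0 with hl | rfl | hl
    · simp only [hl.le, show l + 1 ≤ 0 by omega, if_true]
      exact close_self (loop_adj ω)
    · simpa using h
    · simp only [not_le.2 hl, show ¬ l + 1 ≤ 0 by omega, if_false]
      exact close_self (loop_adj ω')
  · by_cases hl : l ≤ 0
    · simpa only [hl, if_true] using ω.2
    · simpa only [hl, if_false] using ω'.2
  · simp only [hl, if_true]
  · simp only [show ¬ l ≤ 0 by omega, if_false]

end RowAction

/-! ## Points, lifts and words -/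

variable {R : Type u} [Ring R] {m : ℕ}

lemma stPoint_mul_val (x g : St R (m + 1)) : (stPoint (x * g)).1 =
    (stPoint x).1 ᵥ* (theta (m + 1) g : Matrix (Fin (m + 1)) (Fin (m + 1)) R) := by
  simp only [stPoint, map_mul, Units.val_mul, Matrix.vecMul_vecMul]

lemma mem_PTilde {y : St R (m + 1)} : y ∈ PTilde R m ↔ stPoint y = baseEUm R m :=
  ⟨fun h => Subtype.ext h.1, fun h => ⟨congrArg Subtype.val h, theta_mem_En y⟩⟩

lemma stPoint_one : stPoint (1 : St R (m + 1)) = baseEUm R m := mem_PTilde.1 (one_mem _)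

lemma stPoint_mul_right {x y : St R (m + 1)} (h : stPoint x = stPoint y) (g : St R (m + 1)) :
    stPoint (x * g) = stPoint (y * g) := by
  apply Subtype.ext
  rw [stPoint_mul_val, stPoint_mul_val, h]

/-- `PTilde` is the stabilizer of `e` for a right action, so the fibres of `stPoint` are its right
cosets. -/
lemma stPoint_eq_iff {x y : St R (m + 1)} : stPoint x = stPoint y ↔ x * y⁻¹ ∈ PTilde R m := by
  rw [mem_PTilde, ← stPoint_one (R := R)]
  constructor
  · intro h
    simpa using stPoint_mul_right h y⁻¹
  · intro h
    simpa using stPoint_mul_right h y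

/-! ### Lifting edges to the Steinberg group -/

lemma map_theta_locSt {n : ℕ} (a : NilSet n) : (locSt R n a).map (theta n) = locGL R n a := by
  rw [locSt, MonoidHom.map_closure, locGL]
  congr 1
  ext g
  constructor
  · rintro ⟨_, ⟨i, j, h, r, ha, rfl⟩, rfl⟩
    exact ⟨i, j, h, r, ha, theta_stX i j h r⟩
  · rintro ⟨i, j, h, r, ha, rfl⟩
    exact ⟨_, ⟨i, j, h, r, ha, rfl⟩, theta_stX i j h r⟩

lemma map_theta_top {n : ℕ} : (⊤ : Subgroup (St R n)).map (theta n) = En R n := by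
  apply le_antisymm
  · rintro _ ⟨y, -, rfl⟩
    exact theta_mem_En y
  · rw [En, Subgroup.closure_le]
    rintro _ ⟨i, j, h, r, rfl⟩
    exact ⟨stX i j h r, trivial, theta_stX i j h r⟩

lemma adj_stPoint {a : NilSet (m + 1)} (x : St R (m + 1)) {g : St R (m + 1)}
    (hg : g ∈ locSt R (m + 1) a) : Adj a (stPoint x) (stPoint (x * g)) :=
  ⟨theta (m + 1) g, (map_theta_locSt a).le (Subgroup.mem_map_of_mem _ hg), stPoint_mul_val x g⟩

lemma exists_lift {a : NilSet (m + 1)} {x : St R (m + 1)} {v : EUmSet R m}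
    (h : Adj a (stPoint x) v) : ∃ g ∈ locSt R (m + 1) a, v = stPoint (x * g) := by
  obtain ⟨g, hg, h⟩ := h
  rw [← map_theta_locSt] at hg
  obtain ⟨g, hg, rfl⟩ := hg
  exact ⟨g, hg, Subtype.ext (by rw [h, stPoint_mul_val])⟩

lemma PTilde2_le : PTilde2 R m ≤ PTilde R m :=
  (Subgroup.closure_le _).2 fun _ h => h.1

/-- An edge lifts uniquely modulo `(θ⁻¹(EP))₂`. -/
lemma lift_unique {a b : NilSet (m + 1)} {x g h : St R (m + 1)} (hg : g ∈ locSt R (m + 1) a)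
    (hh : h ∈ locSt R (m + 1) b) (e : stPoint (x * g) = stPoint (x * h)) :
    (x * g) * (x * h)⁻¹ ∈ PTilde2 R m :=
  Subgroup.subset_closure ⟨stPoint_eq_iff.1 e, x⁻¹, trivial, a, b, g, hg, h⁻¹, inv_mem hh,
    by group⟩

/-- Conjugation by `y` replaces the `x` of a generator by `x * y`. Normality reconciles the right
quotients produced by lifting with the left cosets of `PTildeQuot`. -/
lemma conj_mem_PTilde2 {y z : St R (m + 1)} (hy : y ∈ PTilde R m) (hz : z ∈ PTilde2 R m) :
    y⁻¹ * z * y ∈ PTilde2 R m := by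
  have : PTilde2 R m ≤ (PTilde2 R m).comap (MulAut.conj y⁻¹).toMonoidHom := by
    refine (Subgroup.closure_le _).2 ?_
    rintro _ ⟨h, x, -, a, b, g, hg, g', hg', rfl⟩
    refine Subgroup.subset_closure ⟨?_, x * y, trivial, a, b, g, hg, g', hg', ?_⟩
    · simpa using mul_mem (mul_mem (inv_mem hy) h) hy
    · simp [mul_assoc]
  simpa using this hz

/-! ### Loops as words in local elements -/

/-- Membership in some local subgroup of the Steinberg group. -/
def IsLocal (y : St R (m + 1)) : Prop := ∃ a, y ∈ locSt R (m + 1) a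

/-- The sequence of points determined by a word which starts at time `N`. -/
def wordPath (N : ℤ) (l : List (St R (m + 1))) (k : ℤ) : EUmSet R m :=
  stPoint (l.take (k - N).toNat).prod

lemma wordPath_of_le {N k : ℤ} (l : List (St R (m + 1))) (h : k ≤ N) :
    wordPath N l k = baseEUm R m := by
  rw [wordPath, Int.toNat_of_nonpos (by omega), List.take_zero, List.prod_nil, stPoint_one]

lemma wordPath_of_ge {N k : ℤ} (l : List (St R (m + 1))) (h : N + l.length ≤ k) :
    wordPath N l k = stPoint l.prod := by
  rw [wordPath, List.take_of_length_le (by omega)]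

lemma isLocal_one : IsLocal (1 : St R (m + 1)) :=
  ⟨⟨∅, fun _ _ h => h.elim, fun _ _ h => h.elim, fun _ _ _ h => h.elim⟩, one_mem _⟩

/-- Consecutive partial products of a word of local elements differ by a local element. -/
lemma exists_prod_take_succ {l : List (St R (m + 1))} (hl : ∀ y ∈ l, IsLocal y) (N k : ℤ) :
    ∃ g, IsLocal g ∧
      (l.take (k + 1 - N).toNat).prod = (l.take (k - N).toNat).prod * g := by
  by_cases h : k < N
  · exact ⟨1, isLocal_one, by
      rw [Int.toNat_of_nonpos (by omega), Int.toNat_of_nonpos (by omega)]; simp⟩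
  · obtain ⟨j, rfl⟩ : ∃ j : ℕ, k = N + j := ⟨(k - N).toNat, by omega⟩
    rw [show (N + j + 1 - N).toNat = j + 1 by omega, show (N + j - N).toNat = j by omega]
    by_cases hj : j < l.length
    · exact ⟨l[j], hl _ (List.getElem_mem hj), List.prod_take_succ l j hj⟩
    · refine ⟨1, isLocal_one, ?_⟩
      rw [List.take_of_length_le (by omega), List.take_of_length_le (by omega), mul_one]

lemma wordPath_adj {l : List (St R (m + 1))} (hl : ∀ y ∈ l, IsLocal y) (N k : ℤ) :
    ∃ a, Adj a (wordPath N l k) (wordPath N l (k + 1)) := by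
  obtain ⟨g, ⟨a, hg⟩, h⟩ := exists_prod_take_succ hl N k
  refine ⟨a, ?_⟩
  unfold wordPath
  rw [h]
  exact adj_stPoint _ hg

/-- The loop determined by a word of local elements. -/
def wordLoop (N : ℤ) (l : List (St R (m + 1))) (hl : ∀ y ∈ l, IsLocal y)
    (h : l.prod ∈ PTilde R m) : Loop (EUm R m) (baseEUm R m) :=
  ⟨wordPath N l, isMorphism_line_iff.2 (wordPath_adj hl N), ⟨N, fun _ h => wordPath_of_le l h⟩,
    ⟨N + l.length, fun _ h' => (wordPath_of_ge l h').trans (mem_PTilde.1 h)⟩⟩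

/-- Path lifting, one edge at a time, from a moment before which the loop rests at `e`. -/
lemma exists_wordLoop_eq (ω : Loop (EUm R m) (baseEUm R m)) :
    ∃ (N : ℤ) (l : List (St R (m + 1))) (hl : ∀ y ∈ l, IsLocal y) (h : l.prod ∈ PTilde R m),
      ω = wordLoop N l hl h := by
  obtain ⟨N, hN⟩ := ω.2.2.1
  obtain ⟨M, hM⟩ := ω.2.2.2
  have key : ∀ k : ℕ, ∃ l : List (St R (m + 1)), (∀ y ∈ l, IsLocal y) ∧ l.length = k ∧
      ∀ j ≤ k, ω.1 (N + j) = stPoint (l.take j).prod := by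
    intro k
    induction k with
    | zero =>
      refine ⟨[], by simp, rfl, fun j hj => ?_⟩
      rw [hN _ (by omega)]
      simp [stPoint_one]
    | succ k ih =>
      obtain ⟨l, hl, hlen, h⟩ := ih
      obtain ⟨a, ha⟩ := loop_adj ω (N + k)
      rw [h k le_rfl, List.take_of_length_le hlen.le] at ha
      obtain ⟨g, hg, e⟩ := exists_lift ha
      refine ⟨l ++ [g], ?_, by simp [hlen], fun j hj => ?_⟩
      · intro y hy
        rcases List.mem_append.1 hy with hy | hy
        · exact hl y hy
        · rw [List.mem_singleton.1 hy]
          exact ⟨a, hg⟩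
      · rcases hj.lt_or_eq with hj | rfl
        · rw [h j (by omega), List.take_append_of_le_length (by omega)]
        · rw [List.take_of_length_le (by simp [hlen])]
          simpa [add_assoc] using e
  obtain ⟨l, hl, hlen, h⟩ := key (M - N).toNat
  -- `N + l.length` is at least `M` even if `M < N`, when truncated subtraction makes the word
  -- empty.
  have hend : ∀ k, N + l.length ≤ k → ω.1 k = ω.1 (N + l.length) := by
    intro k hk
    rw [hM k (by omega), hM _ (by omega)]
  have hprod : stPoint l.prod = ω.1 (N + l.length) := by
    rw [h _ hlen.le, List.take_length]
  have hval : ω.1 (N + l.length) = baseEUm R m := by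
    rw [← hend (max M (N + l.length)) (le_max_right _ _), hM _ (le_max_left _ _)]
  refine ⟨N, l, hl, mem_PTilde.2 (hprod.trans hval), Subtype.ext (funext fun k => ?_)⟩
  show ω.1 k = wordPath N l k
  rcases le_total k N with hk | hk
  · rw [wordPath_of_le l hk, hN k hk]
  · rcases le_total (N + l.length) k with hk' | hk'
    · rw [wordPath_of_ge l hk', hend k hk', hprod]
    · have := h (k - N).toNat (by omega)
      rwa [show N + ((k - N).toNat : ℤ) = k by omega] at this

/-- Words of close loops have the same product modulo `(θ⁻¹(EP))₂`. -/
lemma prod_mul_inv_mem_of_close {N N' : ℤ} {l l' : List (St R (m + 1))}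
    (hl : ∀ y ∈ l, IsLocal y) (hl' : ∀ y ∈ l', IsLocal y) (h : l.prod ∈ PTilde R m)
    (h' : l'.prod ∈ PTilde R m) (hc : Close (wordPath N l) (wordPath N' l')) :
    l'.prod * l.prod⁻¹ ∈ PTilde2 R m := by
  let f : ℤ → St R (m + 1) := fun k => (l.take (k - N).toNat).prod
  let f' : ℤ → St R (m + 1) := fun k => (l'.take (k - N').toNat).prod
  -- Invariant: modulo `PTilde2` the two lifts differ by a local letter `c`, which lifts the edge
  -- between the loops at time `k`.
  have step : ∀ k, (∃ c, IsLocal c ∧ f' k * (f k * c)⁻¹ ∈ PTilde2 R m) →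
      ∃ c, IsLocal c ∧ f' (k + 1) * (f (k + 1) * c)⁻¹ ∈ PTilde2 R m := by
    rintro k ⟨c, ⟨b, hb⟩, hcz⟩
    obtain ⟨g, ⟨_, hg⟩, eg⟩ := exists_prod_take_succ hl N k
    obtain ⟨g', ⟨_, hg'⟩, eg'⟩ := exists_prod_take_succ hl' N' k
    change f (k + 1) = f k * g at eg
    change f' (k + 1) = f' k * g' at eg'
    obtain ⟨a, h1, h2, h3⟩ := hc k
    change Adj a (stPoint (f k)) (stPoint (f (k + 1))) at h1
    change Adj a (stPoint (f k)) (stPoint (f' k)) at h2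
    change Adj a (stPoint (f k)) (stPoint (f' (k + 1))) at h3
    -- The square lies in one orbit, so three sides lift to `s`, `t`, `d` in the same local group,
    -- and `s⁻¹ * t * d` lifts the fourth. Exchanging `g`, `c`, `g'` for `s`, `t`, `d` costs factors
    -- in `PTilde2`.
    obtain ⟨s, hs, es⟩ := exists_lift h1
    obtain ⟨t, ht, et⟩ := exists_lift h2
    obtain ⟨d, hd, ed⟩ := exists_lift (h2.symm.trans h3)
    rw [eg] at es
    rw [eg'] at ed
    have u1 := lift_unique hg hs es
    have u2 := lift_unique hg' hd ed
    have e3 : stPoint (f k * c) = stPoint (f k * t) :=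
      (stPoint_eq_iff.2 (PTilde2_le hcz)).symm.trans et
    have u3 := lift_unique hb ht e3
    refine ⟨s⁻¹ * t * d, ⟨a, mul_mem (mul_mem (inv_mem hs) ht) hd⟩, ?_⟩
    rw [eg, eg']
    have e4 : f' k * g' * (f k * g * (s⁻¹ * t * d))⁻¹ =
        (f' k * g' * (f' k * d)⁻¹) * (f' k * (f k * c)⁻¹) * (f k * c * (f k * t)⁻¹) *
          (f k * g * (f k * s)⁻¹)⁻¹ := by group
    rw [e4]
    exact mul_mem (mul_mem (mul_mem u2 hcz) u3) (inv_mem u1)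
  -- At time `min N N'` neither word has begun, so both partial products are `1`.
  have all : ∀ j : ℕ, ∃ c, IsLocal c ∧
      f' (min N N' + j) * (f (min N N' + j) * c)⁻¹ ∈ PTilde2 R m := by
    intro j
    induction j with
    | zero =>
      refine ⟨1, isLocal_one, ?_⟩
      simp only [f, f']
      rw [Int.toNat_of_nonpos (by omega), Int.toNat_of_nonpos (by omega)]
      simp
    | succ j ih => simpa [add_assoc] using step _ ih
  obtain ⟨c, ⟨b, hb⟩, hcz⟩ := all ((max N N' - min N N').toNat + l.length + l'.length)
  simp only [f, f'] at hcz
  rw [List.take_of_length_le (by omega), List.take_of_length_le (by omega)] at hcz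
  -- Both words are now exhausted and both loops are back at `e`, so `c` and `1` lift the same edge.
  have e : stPoint (l.prod * c) = stPoint (l.prod * 1) := by
    rw [← stPoint_eq_iff.2 (PTilde2_le hcz), mul_one, mem_PTilde.1 h, mem_PTilde.1 h']
  have u := lift_unique hb (one_mem (locSt R (m + 1) b)) e
  have := mul_mem hcz u
  simpa [mul_assoc] using this

/-! ## The class of a word -/

open Classical in
/-- The class of the loop determined by a word which starts at time `N`, where this makes sense. -/
noncomputable def wordClass (N : ℤ) (l : List (St R (m + 1))) : Pi1EUm R m :=
  if h : (∀ y ∈ l, IsLocal y) ∧ l.prod ∈ PTilde R m then Pi1.mk _ _ (wordLoop N l h.1 h.2)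
  -- The default value makes the class total, so words can be compared in every context, including
  -- those that do not close up.
  else Pi1EUm.base R m

lemma wordClass_of {N : ℤ} {l : List (St R (m + 1))} (hl : ∀ y ∈ l, IsLocal y)
    (h : l.prod ∈ PTilde R m) : wordClass N l = Pi1.mk _ _ (wordLoop N l hl h) :=
  dif_pos ⟨hl, h⟩

/-- The two equivalences ensure that the default value is taken on both sides or on neither. -/
lemma wordClass_congr {N N' : ℤ} {l l' : List (St R (m + 1))}
    (hl : (∀ y ∈ l, IsLocal y) ↔ ∀ y ∈ l', IsLocal y) (h : l.prod ∈ PTilde R m ↔ l'.prod ∈ PTilde R m)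
    (H : (∀ y ∈ l, IsLocal y) → (∀ y ∈ l', IsLocal y) → Close (wordPath N l) (wordPath N' l')) :
    wordClass N l = wordClass N' l' := by
  by_cases hh : (∀ y ∈ l, IsLocal y) ∧ l.prod ∈ PTilde R m
  · rw [wordClass_of hh.1 hh.2, wordClass_of (hl.1 hh.1) (h.1 hh.2)]
    exact Quot.sound (stablyHomotopic_of_close (H hh.1 (hl.1 hh.1)))
  · rw [wordClass, wordClass, dif_neg hh, dif_neg fun hh' => hh ⟨hl.2 hh'.1, h.2 hh'.2⟩]

lemma wordClass_congr_of_eq {N N' : ℤ} {l l' : List (St R (m + 1))}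
    (hl : (∀ y ∈ l, IsLocal y) ↔ ∀ y ∈ l', IsLocal y) (h : l.prod ∈ PTilde R m ↔ l'.prod ∈ PTilde R m)
    (H : wordPath N l = wordPath N' l') : wordClass N l = wordClass N' l' :=
  wordClass_congr hl h fun hl _ => H ▸ close_self (wordPath_adj hl N)

lemma wordPath_add {N : ℤ} (l : List (St R (m + 1))) (j : ℕ) :
    wordPath N l (N + j) = stPoint (l.take j).prod := by
  simp [wordPath]

lemma wordPath_ext {N : ℤ} {l l' : List (St R (m + 1))}
    (h : ∀ j : ℕ, stPoint (l.take j).prod = stPoint (l'.take j).prod) :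
    wordPath N l = wordPath N l' :=
  funext fun k => h (k - N).toNat

/-- Replacing two consecutive letters in a local group by two others with the same product. -/
lemma wordClass_pair (N : ℤ) (p s : List (St R (m + 1))) {a : NilSet (m + 1)} {x y z t : St R (m + 1)}
    (hx : x ∈ locSt R (m + 1) a) (hy : y ∈ locSt R (m + 1) a) (hz : z ∈ locSt R (m + 1) a)
    (ht : t ∈ locSt R (m + 1) a) (h : x * y = z * t) :
    wordClass N (p ++ x :: y :: s) = wordClass N (p ++ z :: t :: s) := by
  have hx' : IsLocal x := ⟨a, hx⟩
  have hy' : IsLocal y := ⟨a, hy⟩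
  have hz' : IsLocal z := ⟨a, hz⟩
  have ht' : IsLocal t := ⟨a, ht⟩
  -- Only the point between the two letters changes. It and its neighbours come from `p.prod`
  -- multiplied by `1`, `x`, `z`, `x * y`, all in one orbit.
  refine wordClass_congr ?_ ?_ fun hl hl' => close_of_eqOn_compl (wordPath_adj hl N) a
    (N + (p.length + 1 : ℕ)) (fun k hk => ?_) ?_ ?_ ?_
  · simp [or_imp, forall_and, hx', hy', hz', ht']
  · have : (p ++ x :: y :: s).prod = (p ++ z :: t :: s).prod := by
      simp only [List.prod_append, List.prod_cons]
      rw [← mul_assoc x, h, mul_assoc]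
    rw [this]
  · simp only [wordPath]
    rcases lt_or_ge (k - N).toNat (p.length + 1) with h' | h'
    · rw [List.take_append_of_le_length (by omega), List.take_append_of_le_length (by omega)]
    · obtain ⟨j, hj⟩ : ∃ j, (k - N).toNat = p.length + (j + 2) :=
        ⟨(k - N).toNat - p.length - 2, by omega⟩
      rw [hj, List.take_length_add_append, List.take_length_add_append]
      simp only [List.take_succ_cons, List.prod_append, List.prod_cons]
      rw [← mul_assoc x, h, mul_assoc]
  · rw [show N + ((p.length + 1 : ℕ) : ℤ) - 1 = N + (p.length : ℕ) by push_cast; ring,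
      wordPath_add, wordPath_add, List.take_length_add_append, List.take_left]
    simpa using adj_stPoint p.prod hx
  · rw [show N + ((p.length + 1 : ℕ) : ℤ) - 1 = N + (p.length : ℕ) by push_cast; ring,
      wordPath_add, wordPath_add, List.take_length_add_append, List.take_left]
    simpa using adj_stPoint p.prod hz
  · rw [show N + ((p.length + 1 : ℕ) : ℤ) - 1 = N + (p.length : ℕ) by push_cast; ring,
      show N + ((p.length + 1 : ℕ) : ℤ) + 1 = N + (p.length + 2 : ℕ) by push_cast; ring,
      wordPath_add, wordPath_add, List.take_length_add_append, List.take_left]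
    simpa using adj_stPoint p.prod (mul_mem hx hy)

lemma wordClass_append_one (N : ℤ) (l : List (St R (m + 1))) :
    wordClass N (l ++ [1]) = wordClass N l := by
  refine wordClass_congr_of_eq ?_ (by simp) (wordPath_ext fun j => ?_)
  · simp [or_imp, forall_and, isLocal_one]
  · rcases le_or_gt j l.length with h | h
    · rw [List.take_append_of_le_length h]
    · rw [List.take_of_length_le (by simpa using h), List.take_of_length_le h.le]
      simp

/-- The pairs `1, y` and `y, 1` are interchangeable, so the pause travels to the end of the word,
where it is invisible. -/
lemma wordClass_one_insert (N : ℤ) (p s : List (St R (m + 1))) (hs : ∀ y ∈ s, IsLocal y) :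
    wordClass N (p ++ 1 :: s) = wordClass N (p ++ s) := by
  induction s generalizing p with
  | nil => simpa using wordClass_append_one N p
  | cons y s ih =>
    obtain ⟨a, ha⟩ := hs y (by simp)
    rw [wordClass_pair N p s (one_mem _) ha ha (one_mem _) (by simp)]
    simpa using ih (p ++ [y]) fun z hz => hs z (by simp [hz])

lemma wordClass_mul (N : ℤ) (p s : List (St R (m + 1))) (hs : ∀ y ∈ s, IsLocal y)
    {a : NilSet (m + 1)} {x y : St R (m + 1)}
    (hx : x ∈ locSt R (m + 1) a) (hy : y ∈ locSt R (m + 1) a) :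
    wordClass N (p ++ x :: y :: s) = wordClass N (p ++ (x * y) :: s) := by
  -- The pair `x, y` becomes `1, x * y`, and the pause is then dropped.
  rw [wordClass_pair N p s hx hy (one_mem _) (mul_mem hx hy) (by simp)]
  apply wordClass_one_insert
  intro z hz
  rcases List.mem_cons.1 hz with rfl | hz
  exacts [⟨a, mul_mem hx hy⟩, hs z hz]

/-- Replacing a letter by another one which leads to the same point. -/
lemma wordClass_replace (N : ℤ) (p s : List (St R (m + 1))) {x y : St R (m + 1)}
    (hx : IsLocal x) (hy : IsLocal y) (h : stPoint (p.prod * x) = stPoint (p.prod * y)) :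
    wordClass N (p ++ x :: s) = wordClass N (p ++ y :: s) := by
  have key : ∀ s : List (St R (m + 1)),
      stPoint (p ++ x :: s).prod = stPoint (p ++ y :: s).prod := by
    intro s
    simpa [mul_assoc] using stPoint_mul_right h s.prod
  -- No homotopy is needed: the two words trace the same points.
  refine wordClass_congr_of_eq ?_ ?_ (wordPath_ext fun j => ?_)
  · simp [or_imp, forall_and, hx, hy]
  · rw [mem_PTilde, mem_PTilde, key]
  · rcases le_or_gt j p.length with h | h
    · rw [List.take_append_of_le_length h, List.take_append_of_le_length h]
    · obtain ⟨i, rfl⟩ : ∃ i, j = p.length + (i + 1) := ⟨j - p.length - 1, by omega⟩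
      rw [List.take_length_add_append, List.take_length_add_append, List.take_succ_cons,
        List.take_succ_cons, key]

/-- Starting one unit earlier with a pause in front gives the same path. -/
lemma wordClass_sub_one (N : ℤ) {l : List (St R (m + 1))} (hl : ∀ y ∈ l, IsLocal y) :
    wordClass (N - 1) l = wordClass N l := by
  rw [← List.nil_append l, ← wordClass_one_insert (N - 1) [] l hl]
  refine wordClass_congr_of_eq (by simp [isLocal_one]) (by simp) (funext fun k => ?_)
  simp only [wordPath, List.nil_append]
  rcases lt_or_ge k N with h | h
  · rw [Int.toNat_of_nonpos (show k - N ≤ 0 by omega)]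
    obtain h' | h' : (k - (N - 1)).toNat = 0 ∨ (k - (N - 1)).toNat = 1 := by omega
    all_goals simp [h']
  · rw [show (k - (N - 1)).toNat = (k - N).toNat + 1 by omega]
    simp

lemma wordClass_eq_zero (N : ℤ) {l : List (St R (m + 1))} (hl : ∀ y ∈ l, IsLocal y) :
    wordClass N l = wordClass 0 l := by
  induction N using Int.induction_on with
  | zero => rfl
  | succ i ih => rw [← ih, ← wordClass_sub_one _ hl, add_sub_cancel_right]
  | pred i ih => rw [wordClass_sub_one _ hl, ih]

/-! ## The class of a word depends only on its product -/

variable (R m) in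
/-- Words with equal classes in all contexts. -/
noncomputable def wordCon : Con (FreeMonoid {y : St R (m + 1) // IsLocal y}) where
  r w w' := ∀ p s, wordClass 0 (FreeMonoid.toList (p * w * s) |>.map Subtype.val) =
    wordClass 0 (FreeMonoid.toList (p * w' * s) |>.map Subtype.val)
  iseqv := ⟨fun _ _ _ => rfl, fun h p s => (h p s).symm, fun h h' p s => (h p s).trans (h' p s)⟩
  mul' {a b c d} h h' p s := by
    have h1 := h p (c * s)
    have h2 := h' (p * b) s
    simp only [mul_assoc] at h1 h2 ⊢
    exact h1.trans h2

/-- The class of a letter modulo `wordCon`. -/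
noncomputable def letter (y : St R (m + 1)) (h : IsLocal y) : (wordCon R m).Quotient :=
  (wordCon R m).mk' (FreeMonoid.of ⟨y, h⟩)

lemma isLocal_of_map {w : List {y : St R (m + 1) // IsLocal y}} :
    ∀ y ∈ w.map Subtype.val, IsLocal y := by
  intro y hy
  obtain ⟨z, -, rfl⟩ := List.mem_map.1 hy
  exact z.2

lemma letter_mul {a : NilSet (m + 1)} {x y : St R (m + 1)} (hx : x ∈ locSt R (m + 1) a)
    (hy : y ∈ locSt R (m + 1) a) :
    letter x ⟨a, hx⟩ * letter y ⟨a, hy⟩ = letter (x * y) ⟨a, mul_mem hx hy⟩ := by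
  refine (wordCon R m).eq.2 fun p s => ?_
  simpa using wordClass_mul 0 _ _ isLocal_of_map hx hy

lemma letter_one (h : IsLocal (1 : St R (m + 1))) : letter 1 h = 1 := by
  refine (wordCon R m).eq.2 fun p s => ?_
  simpa using wordClass_one_insert 0 _ _ isLocal_of_map

/-- A letter as a unit. -/
noncomputable def letterUnit (y : St R (m + 1)) (h : IsLocal y) : (wordCon R m).Quotientˣ where
  val := letter y h
  inv := letter y⁻¹ (h.imp fun _ => inv_mem)
  val_inv := by
    obtain ⟨a, ha⟩ := h
    rw [letter_mul ha (inv_mem ha)]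
    simp only [mul_inv_cancel]
    exact letter_one _
  inv_val := by
    obtain ⟨a, ha⟩ := h
    rw [letter_mul (inv_mem ha) ha]
    simp only [inv_mul_cancel]
    exact letter_one _

lemma letterUnit_mul {a : NilSet (m + 1)} {x y : St R (m + 1)} (hx : x ∈ locSt R (m + 1) a)
    (hy : y ∈ locSt R (m + 1) a) :
    letterUnit x ⟨a, hx⟩ * letterUnit y ⟨a, hy⟩ = letterUnit (x * y) ⟨a, mul_mem hx hy⟩ :=
  Units.ext (letter_mul hx hy)

variable (R) in
/-- The map of a local group of the Steinberg group to the group of units. -/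
noncomputable def locUnit (a : NilSet (m + 1)) :
    locSt R (m + 1) a →* (wordCon R m).Quotientˣ :=
  MonoidHom.mk' (fun y => letterUnit y.1 ⟨a, y.2⟩) fun x y => (letterUnit_mul x.2 y.2).symm

lemma isLocal_stX (i j : Fin (m + 1)) (h : i ≠ j) (r : R) : IsLocal (stX i j h r) :=
  ⟨⟨{(i, j)}, by simp; grind, by simp; grind, by simp; grind⟩,
    Subgroup.subset_closure ⟨i, j, h, r, rfl, rfl⟩⟩

/-- A letter does not remember which local group it was taken from, so a relation may be checked in
any local group containing its terms. -/
lemma letterUnit_eq_locUnit {a : NilSet (m + 1)} {i j : Fin (m + 1)} (h : i ≠ j)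
    (ha : (i, j) ∈ a.1) (r : R) : letterUnit (stX i j h r) (isLocal_stX i j h r) =
      locUnit R a ⟨stX i j h r, Subgroup.subset_closure ⟨i, j, h, r, ha, rfl⟩⟩ := rfl

/-! ### The Steinberg relations among letters -/

lemma stX_add {n : ℕ} (i j : Fin n) (h : i ≠ j) (r s : R) :
    stX i j h r * stX i j h s = stX i j h (r + s) := by
  have := PresentedGroup.one_of_mem (rels := {x : FreeGroup (StGen R n) | IsSteinbergRelator x})
    (IsSteinbergRelator.add i j h r s)
  rwa [map_mul, map_mul, map_inv, mul_inv_eq_one] at this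

lemma stX_comm {n : ℕ} (i j k l : Fin n) (hij : i ≠ j) (hkl : k ≠ l) (hjk : j ≠ k) (hil : i ≠ l)
    (r s : R) : grpComm (stX i j hij r) (stX k l hkl s) = 1 := by
  have := PresentedGroup.one_of_mem (rels := {x : FreeGroup (StGen R n) | IsSteinbergRelator x})
    (IsSteinbergRelator.comm i j k l hij hkl hjk hil r s)
  rwa [map_grpComm] at this

lemma stX_commutator {n : ℕ} (i j l : Fin n) (hij : i ≠ j) (hjl : j ≠ l) (hil : i ≠ l) (r s : R) :
    grpComm (stX i j hij r) (stX j l hjl s) = stX i l hil (r * s) := by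
  have := PresentedGroup.one_of_mem (rels := {x : FreeGroup (StGen R n) | IsSteinbergRelator x})
    (IsSteinbergRelator.mul i j l hij hjl hil r s)
  rwa [map_mul, map_inv, map_grpComm, mul_inv_eq_one] at this

variable (R m) in
/-- The homomorphism from the Steinberg group which maps `X_{ij}(r)` to its letter. -/
noncomputable def stToUnits : St R (m + 1) →* (wordCon R m).Quotientˣ :=
  PresentedGroup.toGroup
    (f := fun x : StGen R (m + 1) => letterUnit (stX x.1.1.1 x.1.1.2 x.1.2 x.2) (isLocal_stX _ _ _ _))
    (by
      rintro x (⟨i, j, h, r, s⟩ | ⟨i, j, k, l, hij, hkl, hjk, hil, r, s⟩ |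
        ⟨i, j, l, hij, hjl, hil, r, s⟩)
      · simp only [freeX, map_mul, map_inv, FreeGroup.lift_apply_of]
        let a : NilSet (m + 1) := ⟨{(i, j)}, by simp; grind, by simp; grind, by simp; grind⟩
        have ha : (i, j) ∈ a.1 := rfl
        rw [letterUnit_eq_locUnit h ha, letterUnit_eq_locUnit h ha, letterUnit_eq_locUnit h ha,
          mul_inv_eq_one, ← map_mul]
        exact congrArg _ (Subtype.ext (stX_add i j h r s))
      · simp only [freeX, map_grpComm, FreeGroup.lift_apply_of]
        -- By `j ≠ k` and `i ≠ l` the two positions are neither opposite nor composable, so the set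
        -- is nilpotent.
        let a : NilSet (m + 1) := ⟨{(i, j), (k, l)}, by simp; grind, by simp; grind, by simp; grind⟩
        have ha : (i, j) ∈ a.1 := Or.inl rfl
        have ha' : (k, l) ∈ a.1 := Or.inr rfl
        rw [letterUnit_eq_locUnit hij ha, letterUnit_eq_locUnit hkl ha', ← map_grpComm,
          ← map_one (locUnit R a)]
        exact congrArg _ (Subtype.ext (stX_comm i j k l hij hkl hjk hil r s))
      · simp only [freeX, map_mul, map_inv, map_grpComm, FreeGroup.lift_apply_of]
        -- The third position closes the set under composition; the commutator relation then holds
        -- within one local group.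
        let a : NilSet (m + 1) :=
          ⟨{(i, j), (j, l), (i, l)}, by simp; grind, by simp; grind, by simp; grind⟩
        have ha : (i, j) ∈ a.1 := Or.inl rfl
        have ha' : (j, l) ∈ a.1 := Or.inr (Or.inl rfl)
        have ha'' : (i, l) ∈ a.1 := Or.inr (Or.inr rfl)
        rw [letterUnit_eq_locUnit hij ha, letterUnit_eq_locUnit hjl ha',
          letterUnit_eq_locUnit hil ha'', ← map_grpComm, mul_inv_eq_one]
        exact congrArg _ (Subtype.ext (stX_commutator i j l hij hjl hil r s)))

lemma stToUnits_stX (i j : Fin (m + 1)) (h : i ≠ j) (r : R) :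
    stToUnits R m (stX i j h r) = letterUnit (stX i j h r) (isLocal_stX i j h r) :=
  PresentedGroup.toGroup.of _

lemma stToUnits_of_isLocal {y : St R (m + 1)} (h : IsLocal y) :
    stToUnits R m y = letterUnit y h := by
  obtain ⟨a, ha⟩ := h
  have : (stToUnits R m).comp (locSt R (m + 1) a).subtype = locUnit R a := by
    refine MonoidHom.eq_of_eqOn_dense Subgroup.closure_closure_coe_preimage ?_
    rintro ⟨_, _⟩ ⟨i, j, h, r, ha, rfl⟩
    exact stToUnits_stX i j h r
  exact DFunLike.congr_fun this ⟨y, ha⟩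

/-- The class modulo `wordCon` factors through the product of the word, which is the point of
constructing `stToUnits`. -/
lemma mk_word (w : FreeMonoid {y : St R (m + 1) // IsLocal y}) :
    (wordCon R m).mk' w = stToUnits R m (w.toList.map Subtype.val).prod := by
  induction w using FreeMonoid.inductionOn' with
  | one => simp
  | of_mul y w ih =>
    rw [map_mul, ih]
    simp only [FreeMonoid.toList_of_mul, List.map_cons, List.prod_cons, map_mul, Units.val_mul]
    rw [stToUnits_of_isLocal y.2]
    rfl

lemma wordClass_eq_of_prod_eq {l l' : List (St R (m + 1))} (hl : ∀ y ∈ l, IsLocal y)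
    (hl' : ∀ y ∈ l', IsLocal y) (h : l.prod = l'.prod) : wordClass 0 l = wordClass 0 l' := by
  lift l to List {y : St R (m + 1) // IsLocal y} using hl
  lift l' to List {y : St R (m + 1) // IsLocal y} using hl'
  have := mk_word (FreeMonoid.ofList l)
  rw [FreeMonoid.toList_ofList, h, ← FreeMonoid.toList_ofList l', ← mk_word] at this
  simpa using (wordCon R m).eq.1 this 1 1

/-! ### Loop classes of Steinberg group elements -/

lemma exists_word (y : St R (m + 1)) :
    ∃ l : List (St R (m + 1)), (∀ z ∈ l, IsLocal z) ∧ l.prod = y := by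
  have h : y ∈ Subgroup.closure (Set.range (PresentedGroup.of
      (rels := {x : FreeGroup (StGen R (m + 1)) | IsSteinbergRelator x}))) := by
    rw [PresentedGroup.closure_range_of]
    trivial
  induction h using Subgroup.closure_induction with
  | mem z hz =>
    obtain ⟨⟨⟨⟨i, j⟩, hij⟩, r⟩, rfl⟩ := hz
    exact ⟨[stX i j hij r], by simpa using isLocal_stX i j hij r, by simp [stX]⟩
  | one => exact ⟨[], by simp, rfl⟩
  | mul x y _ _ hx hy =>
    obtain ⟨l, hl, rfl⟩ := hx
    obtain ⟨l', hl', rfl⟩ := hy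
    exact ⟨l ++ l', fun z hz => (List.mem_append.1 hz).elim (hl z) (hl' z), by simp⟩
  | inv x _ hx =>
    obtain ⟨l, hl, rfl⟩ := hx
    refine ⟨(l.map (·⁻¹)).reverse, fun z hz => ?_, by rw [List.prod_inv_reverse]⟩
    obtain ⟨y, hy, rfl⟩ := List.mem_map.1 (List.mem_reverse.1 hz)
    exact (hl y hy).imp fun _ => inv_mem

/-- The class of the loops determined by the words with product `y`. -/
noncomputable def stClass (y : St R (m + 1)) : Pi1EUm R m := wordClass 0 (exists_word y).choose

lemma stClass_prod {l : List (St R (m + 1))} (hl : ∀ y ∈ l, IsLocal y) :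
    stClass l.prod = wordClass 0 l :=
  wordClass_eq_of_prod_eq (exists_word l.prod).choose_spec.1 hl (exists_word l.prod).choose_spec.2

/-- Makes the class constant on left cosets of `PTilde2`. For a generator, the words for `y * z` and
for `y` can be chosen to differ in one letter. -/
lemma stClass_mul {y z : St R (m + 1)} (hz : z ∈ PTilde2 R m) (hy : y ∈ PTilde R m) :
    stClass (y * z) = stClass y := by
  induction hz using Subgroup.closure_induction generalizing y with
  | one => rw [mul_one]
  | mem z h =>
    obtain ⟨h, x, -, a, b, g, hg, g', hg', rfl⟩ := h
    obtain ⟨l, hl, rfl⟩ := exists_word y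
    obtain ⟨p, hp, ep⟩ := exists_word x⁻¹
    obtain ⟨s, hs, rfl⟩ := exists_word x
    have hg1 : IsLocal g := ⟨a, hg⟩
    have hg2 : IsLocal g' := ⟨b, hg'⟩
    have hg3 : IsLocal g'⁻¹ := ⟨b, inv_mem hg'⟩
    have e1 : l.prod * (s.prod⁻¹ * g * g' * s.prod) = ((l ++ p) ++ g :: g' :: s).prod := by
      simp [ep, mul_assoc]
    have e2 : l.prod = ((l ++ p) ++ g'⁻¹ :: g' :: s).prod := by
      simp [ep]
    rw [e1, e2, stClass_prod, stClass_prod]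
    -- The letters `g` and `g'⁻¹` reach the same point: the quotient of the two partial products is
    -- the generator conjugated by `l.prod`, an element of `PTilde`.
    · apply wordClass_replace _ _ _ hg1 hg3
      rw [stPoint_eq_iff]
      have := mul_mem (mul_mem hy h) (inv_mem hy)
      convert this using 1
      simp [ep, mul_assoc]
    · simp only [List.mem_append, List.mem_cons]; grind
    · simp only [List.mem_append, List.mem_cons]; grind
  | mul z z' hz hz' ih ih' =>
    rw [← mul_assoc, ih' (mul_mem hy (PTilde2_le hz)), ih hy]
  | inv z hz ih =>
    rw [← ih (mul_mem hy (inv_mem (PTilde2_le hz))), inv_mul_cancel_right]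

/-! ## The identification of the fundamental group -/

lemma loopCoset_exists (ω : Loop (EUm R m) (baseEUm R m)) :
    ∃ (Y : PTilde R m) (N : ℤ) (l : List (St R (m + 1))) (hl : ∀ y ∈ l, IsLocal y)
      (h : l.prod ∈ PTilde R m), ω = wordLoop N l hl h ∧ Y = l.prod := by
  obtain ⟨N, l, hl, h, e⟩ := exists_wordLoop_eq ω
  exact ⟨⟨l.prod, h⟩, N, l, hl, h, e, rfl⟩

/-- The coset of the end point of a lift of a loop. -/
noncomputable def loopCoset (ω : Loop (EUm R m) (baseEUm R m)) : PTildeQuot R m :=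
  (loopCoset_exists ω).choose

lemma coset_eq_of_close {N N' : ℤ} {l l' : List (St R (m + 1))}
    (hl : ∀ y ∈ l, IsLocal y) (hl' : ∀ y ∈ l', IsLocal y) (h : l.prod ∈ PTilde R m)
    (h' : l'.prod ∈ PTilde R m) (hc : Close (wordPath N l) (wordPath N' l')) :
    ((⟨l.prod, h⟩ : PTilde R m) : PTildeQuot R m) = (⟨l'.prod, h'⟩ : PTilde R m) := by
  rw [QuotientGroup.eq, Subgroup.mem_subgroupOf]
  -- Conjugating by `l.prod` turns the right quotient into the left quotient.
  have := conj_mem_PTilde2 h (prod_mul_inv_mem_of_close hl hl' h h' hc)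
  simpa [mul_assoc] using this

lemma loopCoset_eq_of_close {ω ω' : Loop (EUm R m) (baseEUm R m)} (hc : Close ω.1 ω'.1) :
    loopCoset ω = loopCoset ω' := by
  obtain ⟨N, l, hl, h, e, eY⟩ := (loopCoset_exists ω).choose_spec
  obtain ⟨N', l', hl', h', e', eY'⟩ := (loopCoset_exists ω').choose_spec
  have := coset_eq_of_close (N := N) (N' := N') hl hl' h h' (by
    rw [e, e'] at hc
    exact hc)
  rw [loopCoset, loopCoset]
  convert this

lemma loopCoset_wordLoop {N : ℤ} {l : List (St R (m + 1))} (hl : ∀ y ∈ l, IsLocal y)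
    (h : l.prod ∈ PTilde R m) :
    loopCoset (wordLoop N l hl h) = (⟨l.prod, h⟩ : PTilde R m) := by
  obtain ⟨N', l', hl', h', e', eY'⟩ := (loopCoset_exists (wordLoop N l hl h)).choose_spec
  have := coset_eq_of_close (N := N') (N' := N) hl' hl h' h (by
    have e : wordPath N l = wordPath N' l' := congrArg Subtype.val e'
    rw [e]
    exact close_self (wordPath_adj hl' N'))
  rw [loopCoset, ← this]
  exact congrArg _ (Subtype.ext eY')

/-- Consecutive rows of a homotopy are close, and finitely many rows separate the two loops. -/
lemma loopCoset_eq_of_stablyHomotopic {ω ω' : Loop (EUm R m) (baseEUm R m)}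
    (h : StablyHomotopic (EUm R m) (baseEUm R m) ω ω') : loopCoset ω = loopCoset ω' := by
  obtain ⟨H, hH, hp, ⟨N, hN⟩, ⟨M, hM⟩⟩ := h
  let row : ℤ → Loop (EUm R m) (baseEUm R m) := fun n => ⟨fun k => H (k, n), hp n⟩
  have hc : ∀ n, loopCoset (row n) = loopCoset (row (n + 1)) := fun n =>
    loopCoset_eq_of_close (isMorphism_line_prod_iff.1 hH n)
  have hall : ∀ j : ℕ, loopCoset (row N) = loopCoset (row (N + j)) := by
    intro j
    induction j with
    | zero => simp
    | succ j ih => rw [ih, hc]; push_cast; rw [add_assoc]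
  have h1 : row N = ω := Subtype.ext (hN N le_rfl)
  have h2 : row (N + (M - N).toNat) = ω' := Subtype.ext (hM _ (by omega))
  rw [← h1, ← h2]
  exact hall _

variable (R m) in
/-- The identification of the fundamental group with a coset space of the Steinberg group. -/
noncomputable def pi1Equiv : PTildeQuot R m ≃ Pi1EUm R m where
  toFun := Quotient.lift (fun Y : PTilde R m => stClass Y.1) (by
    intro Y Y' h
    have h : Y⁻¹ * Y' ∈ (PTilde2 R m).subgroupOf (PTilde R m) := QuotientGroup.leftRel_apply.1 h
    have := stClass_mul h Y.2
    simpa using this.symm)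
  invFun := Quot.lift loopCoset fun _ _ => loopCoset_eq_of_stablyHomotopic
  left_inv := by
    rintro ⟨Y, hY⟩
    obtain ⟨l, hl, rfl⟩ := exists_word Y
    show Quot.lift loopCoset _ (stClass l.prod) = _
    rw [stClass_prod hl, wordClass_of hl hY]
    exact loopCoset_wordLoop hl hY
  right_inv := by
    rintro ⟨ω⟩
    obtain ⟨N, l, hl, h, rfl⟩ := exists_wordLoop_eq ω
    show Quotient.lift _ _ (loopCoset (wordLoop N l hl h)) = Pi1.mk _ _ (wordLoop N l hl h)
    -- The lift starts at time `N`, whereas `stClass` uses words starting at `0`; shifting time does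
    -- not change the class.
    rw [loopCoset_wordLoop, ← wordClass_of, wordClass_eq_zero N hl, ← stClass_prod hl]
    rfl

lemma pi1Equiv_mk (Y : PTilde R m) : pi1Equiv R m (Y : PTildeQuot R m) = stClass Y.1 := rfl

lemma pi1Equiv_word {l : List (St R (m + 1))} (hl : ∀ y ∈ l, IsLocal y)
    (h : l.prod ∈ PTilde R m) : pi1Equiv R m ((⟨l.prod, h⟩ : PTilde R m) : PTildeQuot R m) =
      Pi1.mk _ _ (wordLoop 0 l hl h) := by
  rw [pi1Equiv_mk, stClass_prod hl, wordClass_of hl h]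

lemma follows_wordLoop {l : List (St R (m + 1))} (hl : ∀ y ∈ l, IsLocal y)
    (h : l.prod ∈ PTilde R m) : Follows (wordLoop 0 l hl h) l := by
  intro k
  show stPoint (l.take (k - 0).toNat).prod = _
  rw [sub_zero]

lemma pi1Equiv_one : pi1Equiv R m ((1 : PTilde R m) : PTildeQuot R m) = Pi1EUm.base R m := by
  have := pi1Equiv_word (R := R) (m := m) (l := []) (by simp) (one_mem _)
  refine this.trans (congrArg _ (Subtype.ext (funext fun k => ?_)))
  show stPoint (([] : List (St R (m + 1))).take _).prod = _
  rw [List.take_nil]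
  exact stPoint_one

/-! ## Path components -/

lemma exists_En_of_pathConnected {n : ℕ} {v w : UmSet R n} (h : PathConnected (Um R n) v w) :
    ∃ ε ∈ En R n, w.1 = v.1 ᵥ* (ε : Matrix (Fin n) (Fin n) R) := by
  obtain ⟨ω, hω, ⟨N, hN⟩, ⟨M, hM⟩⟩ := h
  have key : ∀ j : ℕ, ∃ ε ∈ En R n, (ω (N + j)).1 = v.1 ᵥ* (ε : Matrix (Fin n) (Fin n) R) := by
    intro j
    induction j with
    | zero => exact ⟨1, one_mem _, by simp [hN N le_rfl]⟩
    | succ j ih =>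
      obtain ⟨ε, hε, e⟩ := ih
      obtain ⟨a, g, hg, e'⟩ := isMorphism_line_iff.1 hω (N + j)
      refine ⟨ε * g, mul_mem hε (locGL_le R n a hg), ?_⟩
      rw [Units.val_mul, ← Matrix.vecMul_vecMul, ← e, ← e', Nat.cast_succ, add_assoc]
  obtain ⟨ε, hε, e⟩ := key (M - N).toNat
  rw [hM _ (by omega)] at e
  exact ⟨ε, hε, e⟩

lemma pathConnected_of_adj {n : ℕ} {a : NilSet n} {v w : UmSet R n} (h : Adj a v w) :
    PathConnected (Um R n) v w := by
  refine ⟨fun k => if k ≤ 0 then v else w, isMorphism_line_iff.2 fun k => ⟨a, ?_⟩,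
    ⟨0, fun k hk => if_pos hk⟩, ⟨1, fun k hk => if_neg (by omega)⟩⟩
  rcases lt_trichotomy k 0 with hk | rfl | hk
  · rw [if_pos hk.le, if_pos (by omega)]
    exact Adj.refl _ _
  · simpa using h
  · rw [if_neg (by omega), if_neg (by omega)]
    exact Adj.refl _ _

/-- An elementary matrix lies in the local group of a singleton, so each generator contributes one
edge. -/
lemma pi0_mk_eq {n : ℕ} {v w : UmSet R n} {ε : GLn R n} (hε : ε ∈ En R n)
    (h : w.1 = v.1 ᵥ* (ε : Matrix (Fin n) (Fin n) R)) : Pi0.mk (Um R n) v = Pi0.mk (Um R n) w := by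
  induction hε using Subgroup.closure_induction generalizing v w with
  | mem g hg =>
    obtain ⟨i, j, hij, r, rfl⟩ := hg
    let a : NilSet n := ⟨{(i, j)}, by simp; grind, by simp; grind, by simp; grind⟩
    exact Quot.sound (pathConnected_of_adj (a := a)
      ⟨_, Subgroup.subset_closure ⟨i, j, hij, r, rfl, rfl⟩, h⟩)
  | one =>
    congr 1
    exact Subtype.ext (by simpa using h.symm)
  | mul g g' _ _ ih ih' =>
    refine (ih (w := ⟨_, vecMul_mem_UmSet v.2 g⟩) rfl).trans (ih' ?_)
    rw [h, Units.val_mul, Matrix.vecMul_vecMul]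
  | inv g _ ih =>
    refine (ih ?_).symm
    rw [h, Matrix.vecMul_vecMul, ← Units.val_mul]
    simp

/-! ## Matrices and maps of free right modules -/

/-- Left multiplication by a matrix is a map of right modules. -/
def mulVecRight {n : ℕ} (g : GLn R n) : (Fin n → R) ≃ₗ[Rᵐᵒᵖ] (Fin n → R) where
  toFun x := (g : Matrix (Fin n) (Fin n) R) *ᵥ x
  map_add' := Matrix.mulVec_add _
  map_smul' c x := Matrix.mulVec_smul _ c x
  invFun x := ((g⁻¹ : GLn R n) : Matrix (Fin n) (Fin n) R) *ᵥ x
  left_inv x := by simp [Matrix.mulVec_mulVec, ← Units.val_mul]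
  right_inv x := by simp [Matrix.mulVec_mulVec, ← Units.val_mul]

lemma apply_eq_sum {n : ℕ} {M : Type*} [AddCommGroup M] [Module Rᵐᵒᵖ M]
    (f : (Fin n → R) →ₗ[Rᵐᵒᵖ] M) (x : Fin n → R) :
    f x = ∑ j, MulOpposite.op (x j) • f (Pi.single j 1) := by
  conv_lhs => rw [← Finset.univ_sum_single x, map_sum]
  refine Finset.sum_congr rfl fun j _ => ?_
  rw [← map_smul]
  congr 1
  ext i
  simp [Pi.single_apply]

lemma exists_rowMap_eq {n : ℕ} (f : (Fin n → R) →ₗ[Rᵐᵒᵖ] R) : ∃ v, f = rowMap v := by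
  refine ⟨fun j => f (Pi.single j 1), LinearMap.ext fun x => ?_⟩
  rw [apply_eq_sum]
  rfl

lemma rowMap_injective {n : ℕ} {v w : Fin n → R} (h : rowMap v = rowMap w) : v = w := by
  ext j
  simpa [rowMap] using LinearMap.congr_fun h (Pi.single j 1)

lemma exists_mulVec_eq {n : ℕ} (f : (Fin n → R) →ₗ[Rᵐᵒᵖ] (Fin n → R)) :
    ∃ A : Matrix (Fin n) (Fin n) R, ∀ x, f x = A *ᵥ x := by
  refine ⟨Matrix.of fun i j => f (Pi.single j 1) i, fun x => ?_⟩
  ext i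
  rw [apply_eq_sum]
  simp [Matrix.mulVec, dotProduct]

lemma eq_one_of_mulVec {n : ℕ} {A : Matrix (Fin n) (Fin n) R} (h : ∀ x, A *ᵥ x = x) : A = 1 := by
  ext i j
  simpa [Matrix.one_apply, Pi.single_apply] using congrFun (h (Pi.single j 1)) i

lemma exists_mulVecRight_eq {n : ℕ} (f : (Fin n → R) ≃ₗ[Rᵐᵒᵖ] (Fin n → R)) :
    ∃ g : GLn R n, f = mulVecRight g := by
  obtain ⟨A, hA⟩ := exists_mulVec_eq f.toLinearMap
  obtain ⟨B, hB⟩ := exists_mulVec_eq f.symm.toLinearMap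
  simp only [LinearEquiv.coe_coe] at hA hB
  refine ⟨⟨A, B, eq_one_of_mulVec fun x => ?_, eq_one_of_mulVec fun x => ?_⟩,
    LinearEquiv.ext fun x => hA x⟩
  · rw [← Matrix.mulVec_mulVec, ← hB, ← hA, f.apply_symm_apply]
  · rw [← Matrix.mulVec_mulVec, ← hA, ← hB, f.symm_apply_apply]

lemma rowMap_vecMul {n : ℕ} (v : Fin n → R) (g : GLn R n) (x : Fin n → R) :
    rowMap (v ᵥ* (g : Matrix (Fin n) (Fin n) R)) x = rowMap v (mulVecRight g x) :=
  (Matrix.dotProduct_mulVec v _ x).symm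

lemma rowMap_e1 (x : Fin (m + 1) → R) : rowMap (e1 R m) x = x 0 := by
  simp [rowMap, e1]

/-- Multiplication by `g` identifies the kernels of the rows `v g` and `v`. -/
def kerVecMulEquiv {n : ℕ} (v : Fin n → R) (g : GLn R n) :
    LinearMap.ker (rowMap (v ᵥ* (g : Matrix (Fin n) (Fin n) R))) ≃ₗ[Rᵐᵒᵖ]
      LinearMap.ker (rowMap v) :=
  (mulVecRight g).ofSubmodules _ _ (by
    ext x
    rw [Submodule.mem_map_equiv, LinearMap.mem_ker, LinearMap.mem_ker, rowMap_vecMul,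
      LinearEquiv.apply_symm_apply])

variable (R m) in
/-- The kernel of the first coordinate is free. -/
def kerE1Equiv : LinearMap.ker (rowMap (e1 R m)) ≃ₗ[Rᵐᵒᵖ] (Fin m → R) where
  toFun x i := x.1 i.succ
  map_add' _ _ := rfl
  map_smul' _ _ := rfl
  invFun y := ⟨Fin.cons 0 y, by rw [LinearMap.mem_ker, rowMap_e1]; rfl⟩
  left_inv x := by
    have h : x.1 0 = 0 := (rowMap_e1 x.1).symm.trans (LinearMap.mem_ker.1 x.2)
    apply Subtype.ext
    funext i
    refine Fin.cases h.symm (fun _ => rfl) i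
  right_inv _ := rfl

/-- A unimodular row whose kernel is free can be completed to an invertible matrix. -/
lemma exists_eq_e1_vecMul (v : UmSet R (m + 1))
    (f : LinearMap.ker (rowMap v.1) ≃ₗ[Rᵐᵒᵖ] (Fin m → R)) :
    ∃ σ : GLn R (m + 1), v = e1Mul R m σ := by
  obtain ⟨s, hs⟩ := v.2
  -- The automorphism sends the first coordinate to the summand spanned by `s` and the others to the
  -- kernel, so composing it with the row `v` gives the first coordinate.
  obtain ⟨g, hg⟩ := exists_mulVecRight_eq ((((consEquiv (R := R) m).symm.trans
    (LinearEquiv.prodComm Rᵐᵒᵖ R (Fin m → R))).trans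
    (LinearEquiv.prodCongr f.symm (LinearEquiv.refl Rᵐᵒᵖ R))).trans (kerEquiv hs))
  have key : v.1 ᵥ* (g : Matrix (Fin (m + 1)) (Fin (m + 1)) R) = e1 R m := by
    refine rowMap_injective (LinearMap.ext fun x => ?_)
    rw [rowMap_vecMul, ← hg, rowMap_e1]
    show rowMap v.1 ((f.symm (Fin.tail x)).1 + colMap s (x 0)) = x 0
    rw [map_add, rowMap_colMap hs, LinearMap.mem_ker.1 (f.symm (Fin.tail x)).2, zero_add]
  refine ⟨g⁻¹, Subtype.ext ?_⟩
  show v.1 = e1 R m ᵥ* _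
  rw [← key, Matrix.vecMul_vecMul, ← Units.val_mul]
  simp

/-- A module `P` with `P ⊕ R ≅ R^n` is the kernel of a unimodular row. -/
lemma exists_kerEquiv {n : ℕ} {P : Type*} [AddCommGroup P] [Module Rᵐᵒᵖ P]
    (f : (P × R) ≃ₗ[Rᵐᵒᵖ] (Fin n → R)) :
    ∃ v : UmSet R n, Nonempty (LinearMap.ker (rowMap v.1) ≃ₗ[Rᵐᵒᵖ] P) := by
  -- The row represents the projection of `P × R` to `R`; the image of `(0, 1)` shows that it is
  -- unimodular.
  obtain ⟨v, hv⟩ := exists_rowMap_eq (LinearMap.snd Rᵐᵒᵖ P R ∘ₗ f.symm.toLinearMap)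
  have hv' : ∀ x, rowMap v x = (f.symm x).2 := fun x => (LinearMap.congr_fun hv x).symm
  refine ⟨⟨v, f (0, 1), ?_⟩, ⟨?_⟩⟩
  · show rowMap v _ = 1
    rw [hv', f.symm_apply_apply]
  · exact
    { toFun := fun x => (f.symm x.1).1
      map_add' := fun x y => by simp
      map_smul' := fun c x => by simp
      invFun := fun p => ⟨f (p, 0), by rw [LinearMap.mem_ker, hv', f.symm_apply_apply]⟩
      left_inv := fun x => by
        have h : (f.symm x.1).2 = 0 := (hv' _).symm.trans (LinearMap.mem_ker.1 x.2)
        refine Subtype.ext ?_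
        show f ((f.symm x.1).1, 0) = x.1
        rw [← h, Prod.mk.eta, f.apply_symm_apply]
      right_inv := fun p => by simp }

lemma Ks0.mk_eq_iff {P Q : StablyFree R m} :
    Ks0.mk P = Ks0.mk Q ↔ Nonempty (P.carrier ≃ₗ[Rᵐᵒᵖ] Q.carrier) :=
  Quotient.eq (r := stablyFreeSetoid R m)

/-- A kernel is free of rank `m` exactly when the row can be completed to an invertible matrix, and
the kernels are exactly the modules that become free on adding one copy of `R`. -/
theorem exact_unimodular_rows (R : Type u) [Ring R] (m : ℕ) :
    ∃ (α : K1 R (m + 1) → Pi0 (Um R (m + 1))) (β : Pi0 (Um R (m + 1)) → Ks0 R m)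
      (γ : Ks0 R m → Ks0 R (m + 1)),
      (∀ σ : GLn R (m + 1), α (σ : K1 R (m + 1)) = Pi0.mk (Um R (m + 1)) (e1Mul R m σ)) ∧
      (∀ v : UmSet R (m + 1), β (Pi0.mk (Um R (m + 1)) v) = Ks0.mk (StablyFree.ker v)) ∧
      (∀ P : StablyFree R m, γ (Ks0.mk P) = Ks0.mk P.succ) ∧
      PointedExact α β ((1 : GLn R (m + 1)) : K1 R (m + 1))
        (Pi0.mk (Um R (m + 1)) (baseUm R m)) (Ks0.mk (StablyFree.free m)) ∧
      PointedExact β γ (Pi0.mk (Um R (m + 1)) (baseUm R m))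
        (Ks0.mk (StablyFree.free m)) (Ks0.mk (StablyFree.free (m + 1))) := by
  let α : K1 R (m + 1) → Pi0 (Um R (m + 1)) :=
    Quotient.lift (fun σ => Pi0.mk (Um R (m + 1)) (e1Mul R m σ)) fun σ σ' h => by
      refine pi0_mk_eq (QuotientGroup.leftRel_apply.1 h) ?_
      show e1 R m ᵥ* _ = (e1 R m ᵥ* _) ᵥ* _
      rw [Matrix.vecMul_vecMul, ← Units.val_mul, mul_inv_cancel_left]
  let β : Pi0 (Um R (m + 1)) → Ks0 R m :=
    Quot.lift (fun v => Ks0.mk (StablyFree.ker v)) fun v w h => by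
      obtain ⟨ε, -, e⟩ := exists_En_of_pathConnected h
      obtain rfl : w = ⟨_, vecMul_mem_UmSet v.2 ε⟩ := Subtype.ext e
      exact Ks0.mk_eq_iff.2 ⟨(kerVecMulEquiv v.1 ε).symm⟩
  let γ : Ks0 R m → Ks0 R (m + 1) :=
    Quotient.lift (fun P => Ks0.mk P.succ) fun P Q ⟨f⟩ =>
      Ks0.mk_eq_iff.2 ⟨LinearEquiv.prodCongr f (LinearEquiv.refl Rᵐᵒᵖ R)⟩
  have hα1 : α ((1 : GLn R (m + 1)) : K1 R (m + 1)) = Pi0.mk (Um R (m + 1)) (baseUm R m) := by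
    refine congrArg (Pi0.mk (Um R (m + 1))) (Subtype.ext ?_)
    show e1 R m ᵥ* _ = e1 R m
    simp
  have hβα : ∀ σ : GLn R (m + 1), β (α (σ : K1 R (m + 1))) = Ks0.mk (StablyFree.free m) :=
    fun σ => Ks0.mk_eq_iff.2 ⟨(kerVecMulEquiv (e1 R m) σ).trans (kerE1Equiv R m)⟩
  have hβ1 : β (Pi0.mk (Um R (m + 1)) (baseUm R m)) = Ks0.mk (StablyFree.free m) := by
    rw [← hα1]
    exact hβα 1
  have hγβ : ∀ x, γ (β x) = Ks0.mk (StablyFree.free (m + 1)) := by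
    rintro ⟨v⟩
    obtain ⟨s, hs⟩ := v.2
    exact Ks0.mk_eq_iff.2 ⟨kerEquiv hs⟩
  refine ⟨α, β, γ, fun _ => rfl, fun _ => rfl, fun _ => rfl, ⟨hα1, hβ1, ?_⟩, ⟨hβ1, ?_, ?_⟩⟩
  · rintro ⟨v⟩
    constructor
    · intro h
      obtain ⟨f⟩ := Ks0.mk_eq_iff.1 h
      obtain ⟨σ, hσ⟩ := exists_eq_e1_vecMul v f
      exact ⟨(σ : K1 R (m + 1)), congrArg _ hσ.symm⟩
    · rintro ⟨⟨σ⟩, h⟩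
      rw [← h]
      exact hβα σ
  · rw [← hβ1]
    exact hγβ (Pi0.mk (Um R (m + 1)) (baseUm R m))
  · rintro ⟨P⟩
    constructor
    · intro h
      obtain ⟨f⟩ := Ks0.mk_eq_iff.1 h
      obtain ⟨v, ⟨g⟩⟩ := exists_kerEquiv (P := P.carrier) f
      exact ⟨Pi0.mk _ v, Ks0.mk_eq_iff.2 ⟨g⟩⟩
    · rintro ⟨x, h⟩
      rw [← h]
      exact hγβ x

/-! ## The right diagonal block -/

lemma Pn_zero {σ : GLn R (m + 1)} (h : σ ∈ Pn R m) (j : Fin (m + 1)) :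
    (σ : Matrix (Fin (m + 1)) (Fin (m + 1)) R) 0 j = e1 R m j := by
  have := congrFun (show e1 R m ᵥ* (σ : Matrix _ _ R) = e1 R m from h) j
  simpa [e1, Matrix.single_one_vecMul] using this

/-- The first row of `τ` is `e`, so the first column of `σ` does not enter the block of the product.
-/
lemma rd_mul (σ τ : Pn R m) : rd (σ * τ) = rd σ * rd τ := by
  apply Units.ext
  ext i j
  have h : (τ.1 : Matrix (Fin (m + 1)) (Fin (m + 1)) R) 0 j.succ = 0 := by
    rw [Pn_zero τ.2]
    simp [e1]
  simp [rd, Matrix.mul_apply, Fin.sum_univ_succ, h]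

lemma stab_mem_Pn (τ : GLn R m) : stab m τ ∈ Pn R m := by
  show e1 R m ᵥ* stabMat _ = e1 R m
  ext j
  refine Fin.cases ?_ (fun j => ?_) j <;>
    simp [e1, stabMat]

lemma rd_stab (τ : GLn R m) (h : stab m τ ∈ Pn R m) : rd ⟨stab m τ, h⟩ = τ := by
  apply Units.ext
  ext i j
  simp [rd, stab, stabMat]

lemma EP2_le : EP2 R m ≤ EPn R m := (Subgroup.closure_le _).2 fun _ h => h.1

variable (m) in
/-- The positions below the diagonal in the first column. -/
def firstColumn : NilSet (m + 1) :=
  ⟨{p | p.1 ≠ 0 ∧ p.2 = 0}, by grind, by grind, by grind⟩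

/-- Matrix units in the first column below the diagonal multiply to zero, so products of these
elementary matrices add their entries. -/
lemma exists_mem_locGL_firstColumn (s : Finset (Fin m)) (v : Fin m → R) :
    ∃ g ∈ locGL R (m + 1) (firstColumn m),
      (g : Matrix (Fin (m + 1)) (Fin (m + 1)) R) =
        1 + ∑ i ∈ s, Matrix.single i.succ 0 (v i) := by
  classical
  induction s using Finset.induction_on with
  | empty => exact ⟨1, one_mem _, by simp⟩
  | insert i s hi ih =>
    obtain ⟨g, hg, e⟩ := ih
    refine ⟨elem i.succ 0 (Fin.succ_ne_zero i) (v i) * g, mul_mem (Subgroup.subset_closure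
      ⟨_, _, _, _, ⟨Fin.succ_ne_zero i, rfl⟩, rfl⟩) hg, ?_⟩
    rw [Units.val_mul, e, Finset.sum_insert hi]
    simp only [elem, add_mul, mul_add, one_mul, mul_one, Finset.mul_sum, Finset.sum_add_distrib]
    rw [Finset.sum_eq_zero (f := fun j : Fin m =>
      Matrix.single i.succ 0 (v i) * Matrix.single j.succ 0 (v j))
      fun j _ => Matrix.single_mul_single_of_ne _ _ _ _ (Fin.succ_ne_zero j).symm _]
    abel

/-- A matrix in `P_n(R)` agrees with its right diagonal block up to an element of
`(EP_n(R))₂`. -/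
lemma exists_eq_mul_stab_rd (σ : Pn R m) : ∃ g ∈ EP2 R m, σ.1 = stab m (rd σ) * g := by
  -- `τ` has first row `e` and identity block, so only its first column is free and it lies in one
  -- local group. It is a generator of `EP2` with `x = b = 1`.
  let τ : GLn R (m + 1) := (stab m (rd σ))⁻¹ * σ.1
  have hτ : τ ∈ Pn R m := mul_mem (inv_mem (stab_mem_Pn _)) σ.2
  have hrd : rd ⟨τ, hτ⟩ = 1 := by
    have h : (⟨τ, hτ⟩ : Pn R m) = ⟨stab m (rd σ), stab_mem_Pn _⟩⁻¹ * σ := rfl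
    have h2 := rd_mul ⟨stab m (rd σ), stab_mem_Pn _⟩ ⟨τ, hτ⟩
    rw [rd_stab, h, mul_inv_cancel_left] at h2
    rw [h]
    exact (mul_eq_left.1 h2.symm)
  obtain ⟨g, hg, e⟩ := exists_mem_locGL_firstColumn Finset.univ
    (fun i : Fin m => (τ : Matrix (Fin (m + 1)) (Fin (m + 1)) R) i.succ 0)
  have hgτ : g = τ := by
    apply Units.ext
    rw [e]
    ext i j
    rw [Matrix.add_apply, Matrix.sum_apply]
    refine Fin.cases ?_ (fun i => ?_) i
    · rw [Pn_zero hτ]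
      simp [e1, Matrix.one_apply, Pi.single_apply, eq_comm]
    · refine Fin.cases ?_ (fun j => ?_) j
      · simp [Matrix.single_apply]
      · have : (rd ⟨τ, hτ⟩ : Matrix (Fin m) (Fin m) R) i j = (1 : Matrix (Fin m) (Fin m) R) i j := by
          rw [hrd, Units.val_one]
        change (τ : Matrix (Fin (m + 1)) (Fin (m + 1)) R) i.succ j.succ = _ at this
        rw [this]
        simp [Matrix.one_apply, (Fin.succ_ne_zero j).symm]
  refine ⟨τ, Subgroup.subset_closure ⟨⟨hτ, hgτ ▸ locGL_le R _ _ hg⟩, 1, one_mem _, _,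
    firstColumn m, g, hg, 1, one_mem _, by simp [hgτ]⟩, (mul_inv_cancel_left _ _).symm⟩

/-- The first column contributes only a factor in `EP2`, so the block alone decides membership. -/
lemma rd_mem_GL2_iff (σ : Pn R m) : rd σ ∈ GL2 R m ↔ σ.1 ∈ EP2 R m := by
  obtain ⟨g, hg, e⟩ := exists_eq_mul_stab_rd σ
  rw [e, Subgroup.mul_mem_cancel_right _ hg]
  rfl

/-- `θ_n` maps `(θ_n⁻¹(EP_n(R)))₂` onto `(EP_n(R))₂`. -/
lemma map_theta_PTilde2 : (PTilde2 R m).map (theta (m + 1)) = EP2 R m := by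
  rw [PTilde2, EP2, sub2, sub2, MonoidHom.map_closure]
  congr 1
  ext h
  constructor
  · rintro ⟨_, ⟨h, x, -, a, b, g, hg, g', hg', rfl⟩, rfl⟩
    refine ⟨h, theta _ x, theta_mem_En x, a, b, theta _ g, ?_, theta _ g', ?_, by simp⟩
    · exact (map_theta_locSt a).le (Subgroup.mem_map_of_mem _ hg)
    · exact (map_theta_locSt b).le (Subgroup.mem_map_of_mem _ hg')
  · rintro ⟨h, x, hx, a, b, g, hg, g', hg', rfl⟩
    -- The three factors are lifted separately; the lifted product lies in `PTilde` because that is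
    -- a full preimage.
    rw [← map_theta_top] at hx
    rw [← map_theta_locSt] at hg hg'
    obtain ⟨x, -, rfl⟩ := hx
    obtain ⟨g, hg, rfl⟩ := hg
    obtain ⟨g', hg', rfl⟩ := hg'
    refine ⟨x⁻¹ * g * g' * x, ⟨?_, x, trivial, a, b, g, hg, g', hg', rfl⟩, by simp⟩
    show theta (m + 1) _ ∈ EPn R m
    simpa using h

lemma rdTheta_mul (Y Z : PTilde R m) : rdTheta (Y * Z) = rdTheta Y * rdTheta Z := by
  rw [rdTheta, rdTheta, rdTheta, ← rd_mul]
  congr 1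
  exact Subtype.ext (map_mul _ _ _)

lemma rdTheta_mem_GL2 {Y : PTilde R m} (h : Y.1 ∈ PTilde2 R m) : rdTheta Y ∈ GL2 R m :=
  (rd_mem_GL2_iff _).2 (map_theta_PTilde2.le (Subgroup.mem_map_of_mem _ h))

variable (R m) in
/-- The right diagonal block on cosets. -/
def rdCoset : PTildeQuot R m → K1ModTwo R m :=
  Quotient.lift (fun Y : PTilde R m => (rdTheta Y : K1ModTwo R m)) fun Y Z h => by
    have h : Y⁻¹ * Z ∈ (PTilde2 R m).subgroupOf (PTilde R m) := QuotientGroup.leftRel_apply.1 h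
    have h1 := rdTheta_mul Y (Y⁻¹ * Z)
    rw [mul_inv_cancel_left] at h1
    rw [QuotientGroup.eq, h1, inv_mul_cancel_left]
    exact rdTheta_mem_GL2 h

variable (R m) in
/-- The stabilization on cosets. -/
def stabCoset : K1ModTwo R m → K1 R (m + 1) :=
  Quotient.lift (fun τ : GLn R m => (stab m τ : K1 R (m + 1))) fun σ τ h => by
    rw [QuotientGroup.eq, ← map_inv, ← map_mul]
    exact (EP2_le (QuotientGroup.leftRel_apply.1 h : σ⁻¹ * τ ∈ GL2 R m)).2

variable (R m) in
/-- The right diagonal block of a loop. -/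
noncomputable def rdLoop (c : Pi1EUm R m) : K1ModTwo R m := rdCoset R m ((pi1Equiv R m).symm c)

lemma rdLoop_pi1Equiv (Y : PTilde R m) :
    rdLoop R m (pi1Equiv R m (Y : PTildeQuot R m)) = (rdTheta Y : K1ModTwo R m) :=
  congrArg (rdCoset R m) ((pi1Equiv R m).symm_apply_apply _)

lemma stabCoset_mk (τ : GLn R m) :
    stabCoset R m (τ : K1ModTwo R m) = (stab m τ : K1 R (m + 1)) := rfl

lemma rdTheta_one : rdTheta (1 : PTilde R m) = 1 := by
  have := rdTheta_mul (1 : PTilde R m) 1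
  simpa using this

/-- The cosets of elements of `K_{2,n}(R)`. -/
lemma mk_eq_K2_iff (Y : PTilde R m) :
    (∃ Z : K2 R (m + 1), pi1Equiv R m ((⟨Z, K2_le_PTilde m Z.2⟩ : PTilde R m) : PTildeQuot R m) =
      pi1Equiv R m (Y : PTildeQuot R m)) ↔ theta (m + 1) Y.1 ∈ EP2 R m := by
  simp only [EmbeddingLike.apply_eq_iff_eq, QuotientGroup.eq, Subgroup.mem_subgroupOf]
  rw [← map_theta_PTilde2]
  constructor
  · rintro ⟨Z, hZ⟩
    refine ⟨_, hZ, ?_⟩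
    have : theta (m + 1) Z.1 = 1 := Z.2
    simp [this]
  · rintro ⟨W, hW, e⟩
    -- `W` lies in `PTilde2` and has the same image as `Y`, so this correction lands in the kernel
    -- without leaving the coset.
    refine ⟨⟨Y.1 * W⁻¹, ?_⟩, ?_⟩
    · show theta (m + 1) (Y.1 * W⁻¹) = 1
      rw [map_mul, map_inv, e, mul_inv_cancel]
    · simpa using hW

end UmRow

/-- The two exact sequences of pointed sets, for `n = m + 1 ≥ 3`. In the second one `Φ` is the
identification of `θ_n⁻¹(EP_n(R)) / (θ_n⁻¹(EP_n(R)))₂` with `π_1(EUm_n(R))`, which sends the coset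
of a product `y₁ ⋯ y_k` of elements of local groups of the Steinberg group to the class of the loop
`e, e θ(y₁), …, e θ(y₁ ⋯ y_k) = e`. -/
theorem proposition5p1 {R : Type u} [Ring R] (m : ℕ) (hm : 2 ≤ m) :
    (∃ (α : K1 R (m + 1) → Pi0 (Um R (m + 1))) (β : Pi0 (Um R (m + 1)) → Ks0 R m)
      (γ : Ks0 R m → Ks0 R (m + 1)),
      (∀ σ : GLn R (m + 1), α (σ : K1 R (m + 1)) = Pi0.mk (Um R (m + 1)) (e1Mul R m σ)) ∧
      (∀ v : UmSet R (m + 1), β (Pi0.mk (Um R (m + 1)) v) = Ks0.mk (StablyFree.ker v)) ∧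
      (∀ P : StablyFree R m, γ (Ks0.mk P) = Ks0.mk P.succ) ∧
      PointedExact α β ((1 : GLn R (m + 1)) : K1 R (m + 1))
        (Pi0.mk (Um R (m + 1)) (baseUm R m)) (Ks0.mk (StablyFree.free m)) ∧
      PointedExact β γ (Pi0.mk (Um R (m + 1)) (baseUm R m))
        (Ks0.mk (StablyFree.free m)) (Ks0.mk (StablyFree.free (m + 1)))) ∧
    (∃ (Φ : PTildeQuot R m ≃ Pi1EUm R m) (δ : K2Two R m → K2 R (m + 1))
      (η : K2 R (m + 1) → Pi1EUm R m) (μ : Pi1EUm R m → K1ModTwo R m)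
      (lam : K1ModTwo R m → K1 R (m + 1)),
      (∀ (l : List (St R (m + 1))) (_ : ∀ y ∈ l, ∃ a, y ∈ locSt R (m + 1) a)
        (h : l.prod ∈ PTilde R m), ∃ ω : Loop (EUm R m) (baseEUm R m),
        Follows ω l ∧ Φ ((⟨l.prod, h⟩ : PTilde R m) : PTildeQuot R m) = Pi1.mk _ _ ω) ∧
      (∀ Y : K2Two R m, (δ Y : St R (m + 1)) = Y) ∧
      (∀ Y : K2 R (m + 1),
        η Y = Φ ((⟨Y, K2_le_PTilde m Y.2⟩ : PTilde R m) : PTildeQuot R m)) ∧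
      (∀ Y : PTilde R m, μ (Φ (Y : PTildeQuot R m)) = (rdTheta Y : K1ModTwo R m)) ∧
      (∀ τ : GLn R m, lam (τ : K1ModTwo R m) = (stab m τ : K1 R (m + 1))) ∧
      PointedExact δ η 1 1 (Pi1EUm.base R m) ∧
      PointedExact η μ 1 (Pi1EUm.base R m) ((1 : GLn R m) : K1ModTwo R m) ∧
      PointedExact μ lam (Pi1EUm.base R m) ((1 : GLn R m) : K1ModTwo R m)
        ((1 : GLn R (m + 1)) : K1 R (m + 1))) := by
  refine ⟨exact_unimodular_rows R m, pi1Equiv R m, fun Y => ⟨Y, Y.2.1⟩,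
    fun Y => pi1Equiv R m ((⟨Y, K2_le_PTilde m Y.2⟩ : PTilde R m) : PTildeQuot R m),
    rdLoop R m, stabCoset R m, ?_, fun _ => rfl, fun _ => rfl,
    rdLoop_pi1Equiv, stabCoset_mk,
    ⟨rfl, pi1Equiv_one, fun Y => ?_⟩, ⟨pi1Equiv_one, ?_, fun c => ?_⟩, ⟨?_, ?_, fun t => ?_⟩⟩
  · intro l hl h
    exact ⟨wordLoop 0 l hl h, follows_wordLoop hl h, pi1Equiv_word hl h⟩
  · rw [← pi1Equiv_one, (pi1Equiv R m).apply_eq_iff_eq, eq_comm, QuotientGroup.eq, inv_one, one_mul,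
      Subgroup.mem_subgroupOf]
    constructor
    · intro h
      exact ⟨⟨Y, Y.2, h⟩, rfl⟩
    · rintro ⟨Z, rfl⟩
      exact Z.2.2
  · rw [← pi1Equiv_one, rdLoop_pi1Equiv, rdTheta_one]
  · obtain ⟨Y, rfl⟩ := (pi1Equiv R m).surjective c
    obtain ⟨Y, rfl⟩ := QuotientGroup.mk_surjective Y
    refine Iff.trans ?_ (mk_eq_K2_iff Y).symm
    rw [rdLoop_pi1Equiv, eq_comm, QuotientGroup.eq, inv_one, one_mul]
    exact rd_mem_GL2_iff _
  · rw [← pi1Equiv_one, rdLoop_pi1Equiv, rdTheta_one]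
  · rw [stabCoset_mk, map_one]
  · obtain ⟨τ, rfl⟩ := QuotientGroup.mk_surjective t
    rw [stabCoset_mk, eq_comm, QuotientGroup.eq, inv_one, one_mul, ← map_theta_top]
    constructor
    · rintro ⟨Y, -, hY⟩
      -- Any lift of the stabilized matrix works, since that matrix already fixes `e`.
      have hY' : Y ∈ PTilde R m := ⟨hY ▸ stab_mem_Pn τ, theta_mem_En Y⟩
      refine ⟨pi1Equiv R m (⟨Y, hY'⟩ : PTilde R m), ?_⟩
      rw [rdLoop_pi1Equiv]
      refine congrArg (QuotientGroup.mk (s := GL2 R m)) ?_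
      simp only [rdTheta, hY]
      exact rd_stab τ _
    · rintro ⟨c, hc⟩
      obtain ⟨Y, rfl⟩ := (pi1Equiv R m).surjective c
      obtain ⟨Y, rfl⟩ := QuotientGroup.mk_surjective Y
      rw [rdLoop_pi1Equiv] at hc
      have hc : (rdTheta Y)⁻¹ * τ ∈ GL2 R m := QuotientGroup.eq.1 hc
      -- Removing the factor in `EP2` shows that the stabilized block of `θ(Y)` is elementary; `τ`
      -- differs from that block by an element of `GL2`.
      obtain ⟨g, hg, e⟩ := exists_eq_mul_stab_rd ⟨theta (m + 1) Y.1, Y.2.1⟩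
      have h1 : stab m (rdTheta Y) ∈ En R (m + 1) :=
        (Subgroup.mul_mem_cancel_right _ (EP2_le hg).2).1 (e ▸ theta_mem_En Y.1)
      rw [map_theta_top, ← mul_inv_cancel_left (rdTheta Y) τ, map_mul]
      exact mul_mem h1 (EP2_le (show stab m _ ∈ EP2 R m from hc)).2
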